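/- **Conventions.** A $C$-colored graph is a finite directed graph with half-edges and without directed cycles, whose edges are colored by the set $C$ and in which the inputs and outputs of the graph and of each vertex are linearly ordered; a single edge without vertices and the empty graph are allowed. Let $\mathtt{Gr}$ be one of the following three families of graphs: all such graphs, the connected ones (in particular nonempty), or the simply connected ones. A small simplicial $\mathtt{Gr}$-prop $\mathcal P$ consists of a set of colors $C$, simplicial sets $\mathcal P(\underline c;\underline d)$ for all pairs of finite lists $\underline c,\underline d$ of colors, and composition maps $\gamma_G:\prod_{v}\mathcal P(\mathrm{in}(v);\mathrm{out}(v))\to\mathcal P(\mathrm{in}(G);\mathrm{out}(G))$ for all $C$-colored $G\in\mathtt{Gr}$, which are unital (the composition along a one-vertex standard corolla is the identity), invariant under isomorphisms that preserve all structure, and associative for graph substitution; the unit elements are the compositions along the graphs with one edge and no vertices. Morphisms consist of a map of colors and maps of simplicial sets compatible with all compositions. For the three families these are the categories $\mathbf{sProp}$, $\mathbf{sProperad}$ and $\mathbf{sDioperad}$. Let $U$ denote each of the functors from these categories to the category $\mathbf{sCat}$ of small simplicial categories that keep only the operations with one input and one output, and let $\pi_0:\mathbf{sCat}\to\mathbf{Cat}$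 replace each simplicial set of morphisms by its set of connected components. **Proposition.** The forgetful functors $U_1:\mathbf{sProperad}\to\mathbf{sDioperad}$ and $U_0:\mathbf{sProp}\to\mathbf{sProperad}$ (which commute with the functors $U$ to $\mathbf{sCat}$) have left adjoints $L_1$ and $L_0$, and the adjunctions $L_1\dashv U_1$ and $L_0\dashv U_0$ over $\mathbf{sCat}$ are categorically well-behaved. That is, the left adjoints (which are unique up to unique isomorphism) can be chosen such that for $i=1$ and every simplicial dioperad $\mathcal P$, and for $i=0$ and every simplicial properad $\mathcal P$, the unit $\eta_{\mathcal P}:\mathcal P\to U_iL_i\mathcal P$ of the adjunction has the following properties: 1. the functor $\pi_0U(\eta_{\mathcal P}):\pi_0U\mathcal P\to\pi_0UU_iL_i\mathcal P$ is the identity on objects; 2. the map $\operatorname{Iso}(\pi_0U\mathcal P)\to\operatorname{Iso}(\pi_0UU_iL_i\mathcal P)$ between the sets of all isomorphisms of these categories that is induced by $\pi_0U(\eta_{\mathcal P})$ is a bijection. -/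

import Mathlib

open CategoryTheory MonoidalCategory

universe u

namespace GraphProp

/-! ### Profiles and coloured graphs -/

/-- A profile in a set of colours `C`: a finite ordered list of elements of `C`. -/
@[ext]
structure Profile (C : Type u) where
  length : ℕ
  color : Fin length → C

/-- The profile obtained by applying a map of colours entrywise. -/
def Profile.map {C D : Type*} (f : C → D) (c : Profile C) : Profile D where
  length := c.length
  color i := f (c.color i)

/-- The profile consisting of one colour. -/
def Profile.single {C : Type u} (x : C) : Profile C where
  length := 1
  color _ := x

/-- `Ends c b` is the disjoint union of the positions of the profile `c` and the positions of all
the profiles `b v`. For a graph with input profile `c` whose vertex `v` has output profile `b v`,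
these are the places where an edge can start; for a graph with output profile `d` whose vertex `v`
has input profile `a v`, the elements of `Ends d a` are the places where an edge can end. -/
abbrev Ends {C : Type u} {V : Type} (c : Profile C) (b : V → Profile C) : Type :=
  Fin c.length ⊕ (Σ v : V, Fin (b v).length)

/-- The colour attached to a start or an end of an edge. -/
def endColor {C : Type u} {V : Type} (c : Profile C) (b : V → Profile C) : Ends c b → C
  | .inl i => c.color i
  | .inr p => (b p.1).color p.2

/-- A `C`-coloured directed graph with half-edges and without directed cycles, with vertex set `V`,
where the (ordered, coloured) inputs and outputs of the vertex `v` form the profiles `a v` and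
`b v`, and the (ordered, coloured) inputs and outputs of the graph form the profiles `c` and `d`.

Every edge starts at exactly one place (an input of the graph or an output of a vertex) and ends at
exactly one place (an output of the graph or an input of a vertex), and every such place
belongs to exactly one edge. So the edges are given by a colour-preserving bijection `wire`, and
the set of edges may be identified with `Ends c b`. An edge from an input of the graph to an
output of the graph is an edge that touches no vertex. -/
@[ext]
structure ColoredGraph {C : Type u} {V : Type} (a b : V → Profile C) (c d : Profile C) where
  wire : Ends c b ≃ Ends d a
  color_wire : ∀ e, endColor d a (wire e) = endColor c b e
  acyclic : ∀ v : V, ¬ Relation.TransGen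
    (fun v w : V => ∃ i j, wire (.inr ⟨v, i⟩) = .inr ⟨w, j⟩) v v

namespace ColoredGraph

section

variable {C : Type u} {V : Type} {a b : V → Profile C} {c d : Profile C}

/-- The vertex `v` is the starting point or the end point of the edge `e`. -/
def Touches (G : ColoredGraph a b c d) (v : V) (e : Ends c b) : Prop :=
  (∃ i, e = .inr ⟨v, i⟩) ∨ (∃ j, G.wire e = .inr ⟨v, j⟩)

/-- The undirected simple graph whose vertices are the vertices and the edges of `G`, where a
vertex is adjacent to every edge that touches it. As `G` has no loops, this is the
barycentric subdivision of the one-dimensional CW complex underlying `G` (with the free ends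
of the legs retracted). -/
def incidence (G : ColoredGraph a b c d) : SimpleGraph (V ⊕ Ends c b) where
  Adj
    | .inl v, .inr e => G.Touches v e
    | .inr e, .inl v => G.Touches v e
    | _, _ => False
  symm := ⟨by rintro (v | e) (w | f) h <;> exact h⟩
  loopless := ⟨by rintro (v | e) h <;> exact h⟩

/-- A graph is connected if its underlying space is connected (in particular nonempty). -/
def IsConnected (G : ColoredGraph a b c d) : Prop := G.incidence.Connected

/-- A graph is simply connected if its underlying space is connected and has no cycles. -/
def IsSimplyConnected (G : ColoredGraph a b c d) : Prop := G.incidence.IsTree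

/-- Applying a map of colours to a coloured graph. -/
def mapColors {D : Type u} (f : C → D) (G : ColoredGraph a b c d) :
    ColoredGraph (fun v => (a v).map f) (fun v => (b v).map f) (c.map f) (d.map f) where
  wire := G.wire
  color_wire e := by
    have h := congrArg f (G.color_wire e)
    have key : ∀ {c' : Profile C} {b' : V → Profile C} (e' : Ends c' b'),
        endColor (c'.map f) (fun v => (b' v).map f) e' = f (endColor c' b' e') := by
      rintro c' b' (i | p) <;> rfl
    exact (key _).trans (h.trans (key _).symm)
  acyclic := G.acyclic

/-- The incidence graph does not depend on the colours. -/
def incidenceMapColors {D : Type u} (f : C → D) (G : ColoredGraph a b c d) :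
    (G.mapColors f).incidence ≃g G.incidence where
  toEquiv := Equiv.refl (V ⊕ Ends c b)
  map_rel_iff' := by
    rintro (v | e) (w | e') <;> exact Iff.rfl

/-- `G'` and `G` are strictly isomorphic through the bijection `σ` of their vertices: the
isomorphism respects all colours and all orderings of inputs and outputs. -/
def IsStrictIso {V' : Type} (σ : V' ≃ V) (G' : ColoredGraph (a ∘ σ) (b ∘ σ) c d)
    (G : ColoredGraph a b c d) : Prop :=
  ∀ e : Ends c (b ∘ σ),
    Sum.map id (fun p : Σ v, Fin (a (σ v)).length => (⟨σ p.1, p.2⟩ : Σ v, Fin (a v).length))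
      (G'.wire e) =
    G.wire (Sum.map id
      (fun p : Σ v, Fin (b (σ v)).length => (⟨σ p.1, p.2⟩ : Σ v, Fin (b v).length)) e)

/-- Renaming the vertices of a graph. -/
def reindex {V' : Type} (σ : V' ≃ V) (G : ColoredGraph a b c d) :
    ColoredGraph (a ∘ σ) (b ∘ σ) c d where
  wire := ((Equiv.refl _).sumCongr (Equiv.sigmaCongrLeft (β := fun v => Fin (b v).length) σ)).trans
    (G.wire.trans
      ((Equiv.refl _).sumCongr (Equiv.sigmaCongrLeft (β := fun v => Fin (a v).length) σ)).symm)
  color_wire e := by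
    have h1 : ∀ (c : Profile C) (b : V → Profile C) (e : Ends c (b ∘ σ)), endColor c (b ∘ σ) e =
        endColor c b (((Equiv.refl _).sumCongr
          (Equiv.sigmaCongrLeft (β := fun v => Fin (b v).length) σ)) e) := by
      rintro c b (i | p) <;> rfl
    refine (h1 d a _).trans (Eq.trans ?_ (h1 c b e).symm)
    refine Eq.trans (congrArg (endColor d a) ?_) (G.color_wire _)
    exact Equiv.apply_symm_apply _ _
  acyclic v h := by
    refine G.acyclic (σ v) (Relation.TransGen.lift σ ?_ _ _ h)
    rintro v w ⟨i, j, h⟩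
    refine ⟨i, j, ?_⟩
    exact (Equiv.symm_apply_eq ((Equiv.refl _).sumCongr
      (Equiv.sigmaCongrLeft (β := fun v => Fin (a v).length) σ))).1 h

theorem reindex_isStrictIso {V' : Type} (σ : V' ≃ V) (G : ColoredGraph a b c d) :
    IsStrictIso σ (G.reindex σ) G := by
  intro e
  have h1 : ∀ (c : Profile C) (b : V → Profile C) (e : Ends c (b ∘ σ)), Sum.map id
      (fun p : Σ v, Fin (b (σ v)).length => (⟨σ p.1, p.2⟩ : Σ v, Fin (b v).length)) e =
      ((Equiv.refl _).sumCongr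
        (Equiv.sigmaCongrLeft (β := fun v => Fin (b v).length) σ)) e := by
    rintro c b (i | p) <;> rfl
  refine (h1 d a _).trans ((Equiv.apply_symm_apply _ _).trans (congrArg _ (h1 c b e).symm))

variable {W : V → Type} {a' b' : ∀ v, W v → Profile C}

/-- Consider a graph `G` and for every vertex `v` of `G` a graph `H v` with the same inputs and
outputs as `v`. `Reaches G H e t` says that in the graph obtained by substituting every `H v` for
`v`, the edge of `G` with start `e` leads to the end `t`, which is an output of `G` or an input of
a vertex of some `H v`. If the edge enters `H v` along an edge of `H v` that leads straight to an
output of `H v`, then one has to follow the edge of `G` that starts there. -/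
inductive Reaches (G : ColoredGraph a b c d) (H : ∀ v, ColoredGraph (a' v) (b' v) (a v) (b v)) :
    Ends c b → Ends d (fun x : Σ v, W v => a' x.1 x.2) → Prop
  | exit {e o} : G.wire e = .inl o → Reaches G H e (.inl o)
  | enter {e v j w k} : G.wire e = .inr ⟨v, j⟩ → (H v).wire (.inl j) = .inr ⟨w, k⟩ →
      Reaches G H e (.inr ⟨⟨v, w⟩, k⟩)
  | pass {e v j i t} : G.wire e = .inr ⟨v, j⟩ → (H v).wire (.inl j) = .inl i →
      Reaches G H (.inr ⟨v, i⟩) t → Reaches G H e t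

/-- `K` is the graph substitution `G{H_v}`. -/
structure IsSubstitution (G : ColoredGraph a b c d)
    (H : ∀ v, ColoredGraph (a' v) (b' v) (a v) (b v))
    (K : ColoredGraph (fun x : Σ v, W v => a' x.1 x.2) (fun x : Σ v, W v => b' x.1 x.2) c d) :
    Prop where
  /-- Edges that start at an input of `G`. -/
  input : ∀ i, Reaches G H (.inl i) (K.wire (.inl i))
  /-- Edges inside one of the `H v`. -/
  inner : ∀ v w k w' k', (H v).wire (.inr ⟨w, k⟩) = .inr ⟨w', k'⟩ →
    K.wire (.inr ⟨⟨v, w⟩, k⟩) = .inr ⟨⟨v, w'⟩, k'⟩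
  /-- Edges that start at a vertex of `H v` and leave `H v`. -/
  outer : ∀ v w k i, (H v).wire (.inr ⟨w, k⟩) = .inl i →
    Reaches G H (.inr ⟨v, i⟩) (K.wire (.inr ⟨⟨v, w⟩, k⟩))

end

/-- The standard corolla: one vertex, whose inputs and outputs are those of the graph. -/
def corolla {C : Type u} (c d : Profile C) :
    ColoredGraph (V := Unit) (fun _ => c) (fun _ => d) c d where
  wire :=
    { toFun := fun
        | .inl i => .inr ⟨(), i⟩
        | .inr p => .inl p.2
      invFun := fun
        | .inl i => .inr ⟨(), i⟩
        | .inr p => .inl p.2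
      left_inv := by rintro (i | p) <;> rfl
      right_inv := by rintro (i | p) <;> rfl }
  color_wire := by rintro (i | p) <;> rfl
  acyclic v h := by
    obtain ⟨w, -, i, j, h⟩ := Relation.TransGen.tail'_iff.1 h
    cases h

/-- The places where the edges of a linear graph with `n` vertices start, in their order. -/
def linearStart (n : ℕ) : Fin 1 ⊕ (Σ _ : Fin n, Fin 1) ≃ Fin (n + 1) where
  toFun
    | .inl _ => 0
    | .inr p => p.1.succ
  invFun := Fin.cases (.inl 0) (fun i => .inr ⟨i, 0⟩)
  left_inv := by
    rintro (i | ⟨v, i⟩)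
    · rw [Subsingleton.elim i 0]; rfl
    · rw [Subsingleton.elim i 0]; rfl
  right_inv i := by
    induction i using Fin.cases <;> rfl

/-- The places where the edges of a linear graph with `n` vertices end, in their order. -/
def linearEnd (n : ℕ) : Fin 1 ⊕ (Σ _ : Fin n, Fin 1) ≃ Fin (n + 1) where
  toFun
    | .inl _ => Fin.last n
    | .inr p => p.1.castSucc
  invFun := Fin.lastCases (.inl 0) (fun i => .inr ⟨i, 0⟩)
  left_inv := by
    rintro (i | ⟨v, i⟩)
    · rw [Subsingleton.elim i 0]; simp
    · rw [Subsingleton.elim i 0]; simp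
  right_inv i := by
    induction i using Fin.lastCases <;> simp

/-- The linear graph `x₀ → v₀ → x₁ → v₁ → ⋯ → vₙ₋₁ → xₙ` with `n` vertices, where the `i`-th
vertex has one input, of colour `xᵢ`, and one output, of colour `xᵢ₊₁`. For `n = 0` it
consists of one edge and no vertices. (The colours `xᵢ` with `i > n` are not used.) -/
def linear {C : Type u} (n : ℕ) (x : ℕ → C) :
    ColoredGraph (V := Fin n) (fun i => .single (x i.val)) (fun i => .single (x (i.val + 1)))
      (.single (x 0)) (.single (x n)) where
  wire := (linearStart n).trans (linearEnd n).symm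
  color_wire e := by
    have h1 : ∀ e : Fin 1 ⊕ (Σ _ : Fin n, Fin 1), endColor (.single (x 0))
        (fun i : Fin n => .single (x (i.val + 1))) e = x (linearStart n e).val := by
      rintro (i | ⟨v, i⟩) <;> rfl
    have h2 : ∀ e : Fin 1 ⊕ (Σ _ : Fin n, Fin 1), endColor (.single (x n))
        (fun i : Fin n => .single (x i.val)) e = x (linearEnd n e).val := by
      rintro (i | ⟨v, i⟩) <;> rfl
    exact (h2 _).trans ((congrArg (fun i : Fin (n + 1) => x i.val)
      ((linearEnd n).apply_symm_apply _)).trans (h1 _).symm)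
  acyclic v h := by
    have key : ∀ v w : Fin n, Relation.TransGen (fun v w : Fin n => ∃ i j : Fin 1,
        ((linearStart n).trans (linearEnd n).symm) (.inr ⟨v, i⟩) = .inr ⟨w, j⟩) v w → v < w := by
      intro v w h
      induction h with
      | single h =>
        obtain ⟨i, j, h⟩ := h
        rw [Equiv.trans_apply, Equiv.symm_apply_eq] at h
        have := congrArg Fin.val h
        simp [linearStart, linearEnd] at this
        omega
      | tail _ h ih =>
        obtain ⟨i, j, h⟩ := h
        rw [Equiv.trans_apply, Equiv.symm_apply_eq] at h
        have := congrArg Fin.val h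
        simp [linearStart, linearEnd] at this
        omega
    exact lt_irrefl _ (key v v h)

theorem isTree_of_rank {X : Type*} [Nonempty X] (G : SimpleGraph X) (f : X → ℕ)
    (hf : Function.Injective f) (adj : ∀ x y, G.Adj x y ↔ f x + 1 = f y ∨ f y + 1 = f x)
    (down : ∀ y, f y ≠ 0 → ∃ x, f x + 1 = f y) : G.IsTree := by
  refine ⟨?_, ?_⟩
  · have h0 : ∀ k y, f y = k → ∃ z, f z = 0 ∧ G.Reachable z y := by
      intro k
      induction k with
      | zero => exact fun y hy => ⟨y, hy, .refl _⟩
      | succ k ih =>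
        intro y hy
        obtain ⟨x, hx⟩ := down y (by omega)
        obtain ⟨z, hz, hzx⟩ := ih x (by omega)
        exact ⟨z, hz, hzx.trans (SimpleGraph.Adj.reachable ((adj x y).2 (.inl hx)))⟩
    refine SimpleGraph.Connected.mk fun x y => ?_
    obtain ⟨z, hz, hx⟩ := h0 _ x rfl
    obtain ⟨w, hw, hy⟩ := h0 _ y rfl
    obtain rfl := hf (hz.trans hw.symm)
    exact hx.symm.trans hy
  · have key : ∀ v w, f v + 1 = f w → G.IsBridge s(v, w) := by
      intro v w h hr
      rw [SimpleGraph.reachable_iff_reflTransGen] at hr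
      have : ∀ z, Relation.ReflTransGen (G.deleteEdges {s(v, w)}).Adj v z → f z ≤ f v := by
        intro z hz
        induction hz with
        | refl => exact le_rfl
        | @tail a b _ hab ih =>
          rw [SimpleGraph.deleteEdges_adj, adj] at hab
          by_contra hb
          have ha : a = v := hf (by omega)
          have hbw : b = w := hf (by omega)
          exact hab.2 (by simp [ha, hbw])
      have := this w hr
      omega
    refine SimpleGraph.isAcyclic_iff_forall_adj_isBridge.2 fun v w h => ?_
    rcases (adj v w).1 h with h | h
    · exact key v w h
    · rw [Sym2.eq_swap]; exact key w v h

theorem linear_isSimplyConnected {C : Type u} (n : ℕ) (x : ℕ → C) :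
    (linear n x).IsSimplyConnected := by
  have hn : Nonempty (Fin n ⊕ Ends (.single (x 0)) (fun i : Fin n => .single (x (i.val + 1)))) :=
    ⟨.inr (.inl (0 : Fin 1))⟩
  have ht : ∀ v e, (linear n x).Touches v e ↔
      (linearStart n e = v.succ ∨ linearStart n e = v.castSucc) := by
    intro v e
    refine or_congr ?_ ?_
    · exact ⟨fun ⟨i, h⟩ => (congrArg (linearStart n) h).trans rfl,
        fun h => ⟨(0 : Fin 1), (linearStart n).injective h⟩⟩
    · refine ⟨fun ⟨i, h⟩ => ?_, fun h => ⟨(0 : Fin 1), ?_⟩⟩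
      · exact ((linearEnd n).symm_apply_eq.1 h).trans rfl
      · exact (linearEnd n).symm_apply_eq.2 h
  refine isTree_of_rank _ (Sum.elim (fun v => 2 * v.val + 1) fun e => 2 * (linearStart n e).val)
    ?_ ?_ ?_
  · rintro (v | e) (w | e') h
    · simp at h
      exact congrArg _ (Fin.ext h)
    · simp at h
      omega
    · simp at h
      omega
    · simp at h
      exact congrArg _ ((linearStart n).injective (Fin.ext h))
  · rintro (v | e) (w | e')
    · exact ⟨False.elim, fun h => by simp at h; omega⟩
    · refine (ht v e').trans ?_
      simp [Fin.ext_iff]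
      omega
    · refine (ht w e).trans ?_
      simp [Fin.ext_iff]
      omega
    · exact ⟨False.elim, fun h => by simp at h; omega⟩
  · rintro (v | e) h
    · refine ⟨.inr ((linearStart n).symm v.castSucc), ?_⟩
      have h1 := congrArg Fin.val ((linearStart n).apply_symm_apply v.castSucc)
      rw [Fin.val_castSucc] at h1
      change 2 * ((linearStart n) ((linearStart n).symm v.castSucc)).val + 1 = 2 * v.val + 1
      omega
    · have h1 : 2 * (linearStart n e).val ≠ 0 := h
      refine ⟨.inl ⟨(linearStart n e).val - 1, by have := (linearStart n e).isLt; omega⟩, ?_⟩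
      change 2 * ((linearStart n e).val - 1) + 1 + 1 = 2 * (linearStart n e).val
      omega

theorem linear_wire {C : Type u} (n : ℕ) (x : ℕ → C) (e t : Fin 1 ⊕ (Σ _ : Fin n, Fin 1))
    (h : (linearStart n e).val = (linearEnd n t).val) : (linear n x).wire e = t :=
  (linearEnd n).symm_apply_eq.2 (Fin.ext h)

theorem linear_wire_val {C : Type u} (n : ℕ) (x : ℕ → C) (e t : Fin 1 ⊕ (Σ _ : Fin n, Fin 1))
    (h : (linear n x).wire e = t) : (linearStart n e).val = (linearEnd n t).val :=
  congrArg Fin.val ((linearEnd n).symm_apply_eq.1 h)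

/-- The partial sums of a sequence of natural numbers. -/
def partialSum (m : ℕ → ℕ) : ℕ → ℕ
  | 0 => 0
  | i + 1 => partialSum m i + m i

theorem partialSum_mono (m : ℕ → ℕ) : Monotone (partialSum m) :=
  monotone_nat_of_le_succ fun _ => Nat.le_add_right _ _

/-- Concatenation of blocks of lengths `m 0, …, m (n - 1)`. -/
noncomputable def blockEquiv (m : ℕ → ℕ) (n : ℕ) :
    (Σ v : Fin n, Fin (m v.val)) ≃ Fin (partialSum m n) :=
  Equiv.ofBijective
    (fun p => ⟨partialSum m p.1.val + p.2.val,
      lt_of_lt_of_le (Nat.add_lt_add_left p.2.isLt _)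
        (partialSum_mono m (Nat.succ_le_of_lt p.1.isLt))⟩) (by
      constructor
      · rintro ⟨v, w⟩ ⟨v', w'⟩ h
        have h' : partialSum m v.val + w.val = partialSum m v'.val + w'.val := congrArg Fin.val h
        have aux : ∀ (v v' : Fin n) (w : Fin (m v.val)) (w' : Fin (m v'.val)),
            partialSum m v.val + w.val = partialSum m v'.val + w'.val → ¬ v < v' := by
          intro v v' w w' h hv
          have h1 : partialSum m v.val + m v.val ≤ partialSum m v'.val :=
            partialSum_mono m (Nat.succ_le_of_lt hv)
          have := w.isLt
          omega
        obtain rfl : v = v' := le_antisymm (not_lt.1 (aux _ _ _ _ h'.symm))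
          (not_lt.1 (aux _ _ _ _ h'))
        obtain rfl : w = w' := Fin.ext (by omega)
        rfl
      · intro i
        induction n with
        | zero => exact i.elim0
        | succ n ih =>
          by_cases hi : i.val < partialSum m n
          · obtain ⟨⟨v, w⟩, h⟩ := ih ⟨i.val, hi⟩
            have h1 : partialSum m v.val + w.val = i.val := Fin.ext_iff.1 h
            exact ⟨⟨v.castSucc, w⟩, Fin.ext h1⟩
          · have h1 : i.val < partialSum m n + m n := i.isLt
            refine ⟨⟨Fin.last n, ⟨i.val - partialSum m n, ?_⟩⟩, Fin.ext ?_⟩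
            · change i.val - partialSum m n < m n
              omega
            · change partialSum m n + (i.val - partialSum m n) = i.val
              omega)

/-- Substituting linear graphs into a linear graph gives a linear graph. -/
theorem linear_isSubstitution {C : Type u} (m : ℕ → ℕ) (n : ℕ) (x : ℕ → C) :
    IsSubstitution (linear n fun i => x (partialSum m i))
      (fun v : Fin n => linear (m v.val) fun k => x (partialSum m v.val + k))
      ((linear (partialSum m n) x).reindex (blockEquiv m n)) := by
  -- the position of the end `t`
  let pos : Fin 1 ⊕ (Σ _ : (Σ v : Fin n, Fin (m v.val)), Fin 1) → ℕ := fun t =>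
    (linearEnd _ (Sum.map id (fun p => ⟨blockEquiv m n p.1, p.2⟩) t)).val
  have pos_inj : ∀ t t', pos t = pos t' → t = t' := by
    intro t t' h
    have h1 := (linearEnd _).injective (Fin.ext h)
    rcases t with i | ⟨q, i⟩ <;> rcases t' with i' | ⟨q', i'⟩
    · rw [Subsingleton.elim i i']
    · cases h1
    · cases h1
    · simp at h1
      rw [h1.1, Subsingleton.elim i i']
  -- the edges of the composite graph
  have hK : ∀ e, (linearStart _ (Sum.map id (fun p => ⟨blockEquiv m n p.1, p.2⟩) e)).val =
      pos (((linear (partialSum m n) x).reindex (blockEquiv m n)).wire e) := by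
    intro e
    exact linear_wire_val _ x _ _
      (reindex_isStrictIso (blockEquiv m n) (linear (partialSum m n) x) e).symm
  have key : ∀ l (e : Fin 1 ⊕ (Σ _ : Fin n, Fin 1)) t, (linearStart n e).val + l = n →
      partialSum m (linearStart n e).val = pos t →
      Reaches (linear n fun i => x (partialSum m i))
        (fun v : Fin n => linear (m v.val) fun k => x (partialSum m v.val + k)) e t := by
    intro l
    induction l with
    | zero =>
      intro e t he ht
      obtain rfl : t = .inl (0 : Fin 1) := by
        refine pos_inj _ _ (ht.symm.trans ?_)
        change _ = partialSum m n
        rw [show (linearStart n e).val = n from he]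
      exact .exit (linear_wire n _ e (.inl 0) he)
    | succ l ih =>
      intro e t he ht
      let v : Fin n := ⟨(linearStart n e).val, by omega⟩
      have h1 : (linear n fun i => x (partialSum m i)).wire e = .inr ⟨v, (0 : Fin 1)⟩ :=
        linear_wire n _ e (.inr ⟨v, 0⟩) rfl
      by_cases hm : m v.val = 0
      · refine .pass (i := (0 : Fin 1)) h1
          (linear_wire _ _ (.inl 0) (.inl 0) hm.symm) (ih (.inr ⟨v, 0⟩) t ?_ ?_)
        · change (linearStart n e).val + 1 + l = n
          omega
        · change partialSum m v.val + m v.val = _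
          rw [hm]
          exact ht
      · have h2 : t = .inr ⟨⟨v, ⟨0, by omega⟩⟩, (0 : Fin 1)⟩ := pos_inj _ _ ht.symm
        rw [h2]
        exact .enter h1 (linear_wire _ _ (.inl 0) (.inr ⟨⟨0, by omega⟩, 0⟩) rfl)
  refine ⟨?_, ?_, ?_⟩
  · intro i
    refine key n (.inl i) _ (Nat.zero_add n) ?_
    exact hK (.inl i)
  · intro v w k w' k' h
    have h1 : w.val + 1 = w'.val := linear_wire_val _ _ _ _ h
    refine pos_inj _ _ ((hK _).symm.trans ?_)
    change partialSum m v.val + w.val + 1 = partialSum m v.val + w'.val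
    omega
  · intro v w k i h
    have h1 : w.val + 1 = m v.val := linear_wire_val _ _ _ _ h
    refine key (n - (v.val + 1)) (.inr ⟨v, i⟩) _ ?_ ?_
    · change v.val + 1 + _ = n
      have := v.isLt
      omega
    · refine Eq.trans ?_ (hK (.inr ⟨⟨v, w⟩, k⟩))
      change partialSum m v.val + m v.val = partialSum m v.val + w.val + 1
      omega

theorem corolla_isSimplyConnected {C : Type u} (c d : Profile C) :
    (corolla c d).IsSimplyConnected := by
  have h : (corolla c d).incidence = SimpleGraph.starGraph (.inl ()) := by
    have ht : ∀ e, (corolla c d).Touches () e := by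
      rintro (i | ⟨⟨⟩, i⟩)
      · exact .inr ⟨i, rfl⟩
      · exact .inl ⟨i, rfl⟩
    ext x y
    rw [SimpleGraph.starGraph_adj]
    rcases x with ⟨⟩ | e <;> rcases y with ⟨⟩ | e'
    · exact ⟨False.elim, fun h => h.1 rfl⟩
    · exact ⟨fun _ => ⟨by simp, .inl rfl⟩, fun _ => ht e'⟩
    · exact ⟨fun _ => ⟨by simp, .inr rfl⟩, fun _ => ht e⟩
    · exact ⟨False.elim, fun h => by simp at h⟩
  rw [IsSimplyConnected, h]
  exact SimpleGraph.isTree_starGraph _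

end ColoredGraph

open ColoredGraph

/-! ### Simplicial generalized props -/

/-- The three families of graphs that are used as pasting schemes. -/
inductive PastingScheme
  /-- All directed graphs without directed cycles. -/
  | all
  /-- The connected ones. -/
  | connected
  /-- The simply connected ones. -/
  | simplyConnected

namespace PastingScheme

/-- The graphs that belong to a pasting scheme. -/
def Mem (s : PastingScheme) {C : Type u} {V : Type} {a b : V → Profile C} {c d : Profile C}
    (G : ColoredGraph a b c d) : Prop :=
  match s with
  | all => True
  | connected => G.IsConnected
  | simplyConnected => G.IsSimplyConnected

theorem Mem.of_isSimplyConnected (s : PastingScheme) {C : Type u} {V : Type}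
    {a b : V → Profile C} {c d : Profile C} {G : ColoredGraph a b c d}
    (h : G.IsSimplyConnected) : s.Mem G := by
  cases s
  · trivial
  · exact SimpleGraph.IsTree.connected h
  · exact h

theorem Mem.mapColors {s : PastingScheme} {C : Type u} {D : Type u} {V : Type}
    {a b : V → Profile C} {c d : Profile C} {G : ColoredGraph a b c d} (h : s.Mem G) (f : C → D) :
    s.Mem (G.mapColors f) := by
  cases s
  · trivial
  · exact (G.incidenceMapColors f).connected_iff.2 h
  · exact (G.incidenceMapColors f).isTree_iff.2 h

/-- Every graph that belongs to `s` also belongs to `t`. -/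
def Le (s t : PastingScheme) : Prop :=
  ∀ ⦃C : Type u⦄ ⦃V : Type⦄ ⦃a b : V → Profile C⦄ ⦃c d : Profile C⦄ (G : ColoredGraph a b c d),
    s.Mem G → t.Mem G

theorem simplyConnected_le_connected : Le.{u} simplyConnected connected :=
  fun _ _ _ _ _ _ _ h => SimpleGraph.IsTree.connected h

theorem connected_le_all : Le.{u} connected all :=
  fun _ _ _ _ _ _ _ _ => trivial

end PastingScheme

/-- The product of a family of simplicial sets, formed degreewise. -/
@[simps obj]
def piSSet {V : Type} (X : V → SSet.{u}) : SSet.{u} where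
  obj n := ∀ v, (X v).obj n
  map f := ↾ fun p v => (X v).map f (p v)

/-- A simplicial `Gr(C)`-prop, where `Gr` is the pasting scheme `s` and `C` is the set of colours
(called `Color`). It consists of simplicial sets `hom c d` and of composition maps along all graphs
in the pasting scheme which satisfy the unity, equivariance and associativity conditions. The units
are the compositions along the graphs with one edge and no vertices, see `unit`. The action of
the permutations of inputs and outputs is the composition along the graphs with one vertex. -/
structure SGrProp (s : PastingScheme) where
  Color : Type u
  /-- The simplicial set of operations with inputs `c` and outputs `d`. -/
  hom : Profile Color → Profile Color → SSet.{u}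
  /-- The composition map along a finite graph `G`. -/
  comp {V : Type} [Finite V] {a b : V → Profile Color} {c d : Profile Color}
    (G : ColoredGraph a b c d) (hG : s.Mem G) : piSSet (fun v => hom (a v) (b v)) ⟶ hom c d
  /-- Unity: the composition along a standard corolla is the identity. -/
  comp_corolla (c d : Profile Color) (n : SimplexCategoryᵒᵖ) (p : (hom c d).obj n) :
    (comp (corolla c d) (.of_isSimplyConnected s (corolla_isSimplyConnected c d))).app n
      (fun _ => p) = p
  /-- Equivariance: the composition maps are invariant under strict isomorphisms. -/
  comp_iso {V V' : Type} [Finite V] [Finite V'] (σ : V' ≃ V) {a b : V → Profile Color}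
    {c d : Profile Color} (G' : ColoredGraph (a ∘ σ) (b ∘ σ) c d) (G : ColoredGraph a b c d)
    (hG' : s.Mem G') (hG : s.Mem G) (hσ : IsStrictIso σ G' G) (n : SimplexCategoryᵒᵖ)
    (p : ∀ v, (hom (a v) (b v)).obj n) :
    (comp G' hG').app n (fun v => p (σ v)) = (comp G hG).app n p
  /-- Associativity: the composition along `G{H_v}` is the composition along `G` of the
  compositions along the graphs `H_v`. -/
  comp_subst {V : Type} [Finite V] {W : V → Type} [∀ v, Finite (W v)]
    {a b : V → Profile Color} {c d : Profile Color} {a' b' : ∀ v, W v → Profile Color}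
    (G : ColoredGraph a b c d) (H : ∀ v, ColoredGraph (a' v) (b' v) (a v) (b v))
    (K : ColoredGraph (fun x : Σ v, W v => a' x.1 x.2) (fun x : Σ v, W v => b' x.1 x.2) c d)
    (hG : s.Mem G) (hH : ∀ v, s.Mem (H v)) (hK : s.Mem K) (h : IsSubstitution G H K)
    (n : SimplexCategoryᵒᵖ) (p : ∀ v w, (hom (a' v w) (b' v w)).obj n) :
    (comp K hK).app n (fun x => p x.1 x.2) =
      (comp G hG).app n (fun v => (comp (H v) (hH v)).app n (p v))

namespace SGrProp

variable {s t : PastingScheme}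

/-- A morphism of simplicial `Gr`-props: a map of the sets of colours and maps of simplicial sets
which are compatible with the composition maps (and in particular with units). -/
structure Hom (P Q : SGrProp.{u} s) where
  color : P.Color → Q.Color
  map (c d : Profile P.Color) : P.hom c d ⟶ Q.hom (c.map color) (d.map color)
  map_comp {V : Type} [Finite V] {a b : V → Profile P.Color} {c d : Profile P.Color}
    (G : ColoredGraph a b c d) (hG : s.Mem G) (n : SimplexCategoryᵒᵖ)
    (p : ∀ v, (P.hom (a v) (b v)).obj n) :
    (map c d).app n ((P.comp G hG).app n p) =
      (Q.comp (G.mapColors color) (hG.mapColors color)).app n (fun v => (map _ _).app n (p v))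

instance : Category (SGrProp.{u} s) where
  Hom := Hom
  id _ :=
    { color := id
      map := fun _ _ => 𝟙 _
      map_comp := fun _ _ _ _ => rfl }
  comp f g :=
    { color := g.color ∘ f.color
      map := fun c d => f.map c d ≫ g.map _ _
      map_comp := fun G hG n p =>
        (congrArg _ (f.map_comp G hG n p)).trans (g.map_comp _ _ n _) }
  id_comp _ := rfl
  comp_id _ := rfl
  assoc _ _ _ := rfl

/-- If every graph of the pasting scheme `s` belongs to the pasting scheme `t`, then a simplicial
prop over `t` is a simplicial prop over `s`: forget the compositions along all other graphs. -/
def forget (h : PastingScheme.Le.{u} s t) : SGrProp.{u} t ⥤ SGrProp.{u} s where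
  obj P :=
    { Color := P.Color
      hom := P.hom
      comp := fun G hG => P.comp G (h G hG)
      comp_corolla := fun c d n p => P.comp_corolla c d n p
      comp_iso := fun σ _ _ _ _ G' G _ _ hσ n p => P.comp_iso σ G' G _ _ hσ n p
      comp_subst := fun G H K _ _ _ h n p => P.comp_subst G H K _ _ _ h n p }
  map f :=
    { color := f.color
      map := f.map
      map_comp := fun G hG n p => f.map_comp G (h G hG) n p }
  map_id _ := rfl
  map_comp _ _ := rfl

end SGrProp

/-! ### Simplicial categories and their categories of components -/

/-- The category of small simplicial categories and simplicial functors. -/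
structure SCat where
  Obj : Type u
  [enriched : EnrichedCategory SSet.{u} Obj]

attribute [instance] SCat.enriched

instance : Category SCat.{u} where
  Hom C D := EnrichedFunctor SSet.{u} C.Obj D.Obj
  id C := EnrichedFunctor.id SSet.{u} C.Obj
  comp F G := EnrichedFunctor.comp SSet.{u} F G
  id_comp _ := rfl
  comp_id _ := rfl
  assoc _ _ _ := rfl

/-- The set of objects of the category of components of a simplicial category `C`, which is the
set of objects of `C`. -/
def PiZero (C : SCat.{u}) : Type u := C.Obj

/-- An object of the category of components, as an object of `C`. -/
def PiZero.obj {C : SCat.{u}} (x : PiZero C) : C.Obj := x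

theorem pi0_mk_congr {X Y Z : SSet.{u}} (m : X ⊗ Y ⟶ Z)
    {x x' : X.obj (.op (.mk 0))} {y y' : Y.obj (.op (.mk 0))}
    (e : SSet.Edge x x') (e' : SSet.Edge y y') :
    SSet.π₀.mk (m.app _ (x, y)) = SSet.π₀.mk (m.app _ (x', y')) := by
  have e'' : SSet.Edge (X := X ⊗ Y) (x, y) (x', y') :=
    SSet.Edge.mk (X := X ⊗ Y) (e.edge, e'.edge)
      (Prod.ext e.src_eq e'.src_eq) (Prod.ext e.tgt_eq e'.tgt_eq)
  exact SSet.π₀.sound (e''.map m)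

/-- The map `π₀ X × π₀ Y → π₀ Z` induced by a map `X × Y → Z`. -/
def pi0Map₂ {X Y Z : SSet.{u}} (m : X ⊗ Y ⟶ Z) (x : SSet.π₀ X) (y : SSet.π₀ Y) : SSet.π₀ Z :=
  SSet.π₀.lift (fun x => SSet.π₀.lift (fun y => SSet.π₀.mk (m.app _ (x, y)))
    (fun _ _ e => pi0_mk_congr m (.id _) e) y)
    (fun _ _ e => by
      induction y with
      | mk y => exact pi0_mk_congr m e (.id _)) x

/-- The category of components: its morphisms are the connected components of the simplicial sets
of morphisms. -/
instance (C : SCat.{u}) : Category (PiZero C) where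
  Hom x y := SSet.π₀ (x.obj ⟶[SSet.{u}] y.obj)
  id x := SSet.π₀.mk ((eId SSet.{u} x.obj).app _ PUnit.unit)
  comp {x y z} f g := pi0Map₂ (eComp SSet.{u} x.obj y.obj z.obj) f g
  id_comp {x y} f := by
    induction f with
    | mk f =>
      exact congrArg SSet.π₀.mk
        (ConcreteCategory.congr_hom (NatTrans.congr_app (e_id_comp SSet.{u} x.obj y.obj) _) f)
  comp_id {x y} f := by
    induction f with
    | mk f =>
      exact congrArg SSet.π₀.mk
        (ConcreteCategory.congr_hom (NatTrans.congr_app (e_comp_id SSet.{u} x.obj y.obj) _) f)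
  assoc {x y z w} f g h := by
    induction f with
    | mk f =>
      induction g with
      | mk g =>
        induction h with
        | mk h =>
          have key := NatTrans.congr_app (e_assoc SSet.{u} x.obj y.obj z.obj w.obj) (.op (.mk 0))
          let q : ((x.obj ⟶[SSet.{u}] y.obj) ⊗ (y.obj ⟶[SSet.{u}] z.obj) ⊗
            (z.obj ⟶[SSet.{u}] w.obj)).obj (.op (.mk 0)) := (f, g, h)
          exact congrArg SSet.π₀.mk (ConcreteCategory.congr_hom (C := Type u) key q)

/-- The functor between categories of components induced by a simplicial functor. -/
def piZeroMap {C D : SCat.{u}} (F : C ⟶ D) : PiZero C ⥤ PiZero D where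
  obj x := (EnrichedFunctor.obj F x.obj : D.Obj)
  map {x y} f := SSet.mapπ₀ (EnrichedFunctor.map F x.obj y.obj) f
  map_id x := congrArg SSet.π₀.mk (ConcreteCategory.congr_hom
    (NatTrans.congr_app (EnrichedFunctor.map_id F x.obj) _) PUnit.unit)
  map_comp {x y z} f g := by
    change SSet.π₀ (x.obj ⟶[SSet.{u}] y.obj) at f
    change SSet.π₀ (y.obj ⟶[SSet.{u}] z.obj) at g
    induction f with
    | mk f =>
      induction g with
      | mk g =>
        have key := NatTrans.congr_app (EnrichedFunctor.map_comp F x.obj y.obj z.obj)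
          (.op (.mk 0))
        let q : ((x.obj ⟶[SSet.{u}] y.obj) ⊗ (y.obj ⟶[SSet.{u}] z.obj)).obj
          (.op (.mk 0)) := (f, g)
        exact congrArg SSet.π₀.mk (ConcreteCategory.congr_hom (C := Type u) key q)

/-- The functor that sends a simplicial category to its category of components. -/
def pi0 : SCat.{u} ⥤ Cat.{u, u} where
  obj C := Cat.of (PiZero C)
  map F := (piZeroMap F).toCatHom
  map_id _ := Cat.ext (CategoryTheory.Functor.hext (fun _ => rfl)
    fun _ _ f => heq_of_eq (SSet.mapπ₀_id_apply f))
  map_comp _ _ := Cat.ext (CategoryTheory.Functor.hext (fun _ => rfl)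
    fun _ _ f => heq_of_eq (SSet.mapπ₀_comp_apply _ _ f))

/-! ### The underlying simplicial category of a simplicial `Gr`-prop -/

namespace SGrProp

variable {s t : PastingScheme}

theorem mem_linear (s : PastingScheme) {C : Type u} (n : ℕ) (x : ℕ → C) : s.Mem (linear n x) :=
  .of_isSimplyConnected s (linear_isSimplyConnected n x)

theorem mem_reindex (s : PastingScheme) {C : Type u} {V V' : Type} {a b : V → Profile C}
    {c d : Profile C} (σ : V' ≃ V) {G : ColoredGraph a b c d} (h : G.IsSimplyConnected) :
    s.Mem (G.reindex σ) := by
  refine .of_isSimplyConnected s ?_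
  let τ : (V' ⊕ Ends c (b ∘ σ)) ≃ (V ⊕ Ends c b) := σ.sumCongr
    ((Equiv.refl _).sumCongr (Equiv.sigmaCongrLeft (β := fun v => Fin (b v).length) σ))
  have ht : ∀ v e, G.Touches (σ v) (((Equiv.refl _).sumCongr
      (Equiv.sigmaCongrLeft (β := fun v => Fin (b v).length) σ)) e) ↔
      (G.reindex σ).Touches v e := by
    intro v e
    refine or_congr (exists_congr fun i => ?_) (exists_congr fun i => ?_)
    · exact Equiv.apply_eq_iff_eq ((Equiv.refl _).sumCongr
        (Equiv.sigmaCongrLeft (β := fun v => Fin (b v).length) σ)) (x := e) (y := .inr ⟨v, i⟩)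
    · exact (Equiv.symm_apply_eq ((Equiv.refl _).sumCongr
        (Equiv.sigmaCongrLeft (β := fun v => Fin (a v).length) σ))
          (y := .inr ⟨v, i⟩)).symm
  let iso : (G.reindex σ).incidence ≃g G.incidence :=
    { toEquiv := τ
      map_rel_iff' := by
        rintro (v | e) (w | e')
        · exact Iff.rfl
        · exact ht v e'
        · exact ht w e
        · exact Iff.rfl }
  exact iso.isTree_iff.2 h

theorem comp_congr (P : SGrProp.{u} s) {V : Type} [Finite V] {a b a' b' : V → Profile P.Color}
    {c d : Profile P.Color} {G : ColoredGraph a b c d} {G' : ColoredGraph a' b' c d}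
    (ha : a = a') (hb : b = b') (hw : HEq G.wire G'.wire) (hG : s.Mem G) (hG' : s.Mem G')
    (n : SimplexCategoryᵒᵖ) (p : ∀ v, (P.hom (a v) (b v)).obj n)
    (p' : ∀ v, (P.hom (a' v) (b' v)).obj n) (hp : ∀ v, HEq (p v) (p' v)) :
    (P.comp G hG).app n p = (P.comp G' hG').app n p' := by
  subst ha hb
  obtain rfl : G = G' := ColoredGraph.ext (eq_of_heq hw)
  obtain rfl : p = p' := funext fun v => eq_of_heq (hp v)
  rfl

theorem comp_linear_one (P : SGrProp.{u} s) (x : ℕ → P.Color) (n : SimplexCategoryᵒᵖ)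
    (p : ∀ v : Fin 1, (P.hom (.single (x v.val)) (.single (x (v.val + 1)))).obj n) :
    (P.comp (linear 1 x) (mem_linear s 1 x)).app n p = p 0 := by
  let σ : Fin 1 ≃ Unit := Equiv.ofUnique _ _
  have h1 := P.comp_iso σ ((corolla (.single (x 0)) (.single (x 1))).reindex σ) _
    (mem_reindex s σ (corolla_isSimplyConnected _ _))
    (.of_isSimplyConnected s (corolla_isSimplyConnected _ _)) (reindex_isStrictIso σ _) n
    (fun _ => p 0)
  refine Eq.trans ?_ (h1.trans (P.comp_corolla _ _ n (p 0)))
  refine P.comp_congr (V := Fin 1) (G := linear 1 x)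
    (G' := (corolla (.single (x 0)) (.single (x 1))).reindex σ)
    (funext fun v => ?_) (funext fun v => ?_) (heq_of_eq (Equiv.ext ?_))
    _ _ n p (fun _ => p 0) fun v => ?_
  · rw [Subsingleton.elim v 0]; rfl
  · rw [Subsingleton.elim v 0]; rfl
  · have hw := reindex_isStrictIso σ (corolla (.single (x 0)) (.single (x 1)))
    have key : ∀ t t' : Fin 1 ⊕ (Σ _ : Fin 1, Fin 1), t.isLeft = t'.isLeft → t = t' := by
      rintro (i | ⟨v, i⟩) (j | ⟨w, j⟩) h
      · rw [Subsingleton.elim i j]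
      · cases h
      · cases h
      · rw [Subsingleton.elim i j, Subsingleton.elim v w]
    intro e
    refine key _ _ ?_
    have h2 := congrArg Sum.isLeft (hw e)
    rw [Sum.isLeft_map] at h2
    refine Eq.trans ?_ h2.symm
    change Fin 1 ⊕ (Σ _ : Fin 1, Fin 1) at e
    rcases e with i | ⟨v, i⟩
    · exact congrArg Sum.isLeft (linear_wire 1 x (.inl i) (.inr ⟨0, 0⟩) rfl)
    · refine congrArg Sum.isLeft (linear_wire 1 x (.inr ⟨v, i⟩) (.inl 0) ?_)
      rw [Subsingleton.elim v 0]; rfl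
  · rw [Subsingleton.elim v (0 : Fin 1)]

theorem comp_linear_linear (P : SGrProp.{u} s) (m : ℕ → ℕ) (n : ℕ) (x : ℕ → P.Color)
    (k : SimplexCategoryᵒᵖ)
    (p : ∀ v : Fin (partialSum m n), (P.hom (.single (x v.val)) (.single (x (v.val + 1)))).obj k) :
    (P.comp (linear n fun i => x (partialSum m i)) (mem_linear s _ _)).app k
      (fun v => (P.comp (linear (m v.val) fun k => x (partialSum m v.val + k))
        (mem_linear s _ _)).app k (fun w => p (blockEquiv m n ⟨v, w⟩))) =
      (P.comp (linear (partialSum m n) x) (mem_linear s _ _)).app k p :=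
  (P.comp_subst (V := Fin n) (W := fun v => Fin (m v.val)) _
    (fun v : Fin n => linear (m v.val) fun k => x (partialSum m v.val + k)) _ _
    (fun _ => mem_linear s _ _) (mem_reindex s (blockEquiv m n) (linear_isSimplyConnected _ x))
    (linear_isSubstitution m n x) k (fun v w => p (blockEquiv m n ⟨v, w⟩))).symm.trans
    (P.comp_iso (blockEquiv m n) _ (linear (partialSum m n) x) _ _
      (reindex_isStrictIso _ _) k p)

/-- The simplicial set of operations with one input, of colour `x`, and one output, of
colour `y`. -/
abbrev hom₁ (P : SGrProp.{u} s) (x y : P.Color) : SSet.{u} := P.hom (.single x) (.single y)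

/-- The sequence `x, y, z, z, …`. -/
def seq₃ {C : Type u} (x y z : C) : ℕ → C
  | 0 => x
  | 1 => y
  | _ => z

/-- The unit elements, given by the linear graphs without vertices. -/
def unit (P : SGrProp.{u} s) (x : P.Color) : 𝟙_ SSet.{u} ⟶ P.hom₁ x x :=
  { app := fun n => ↾ fun _ => (fun v : Fin 0 => v.elim0)
    naturality := fun _ _ _ => by ext; exact funext fun v => v.elim0 } ≫
    P.comp (linear 0 fun _ => x) (mem_linear s _ _)

/-- A pair of composable operations with one input and one output, as a decoration of the linear
graph with two vertices. -/
def pair (P : SGrProp.{u} s) {x y z : P.Color} {n : SimplexCategoryᵒᵖ} (f : (P.hom₁ x y).obj n)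
    (g : (P.hom₁ y z).obj n) : ∀ v : Fin 2,
      (P.hom₁ (seq₃ x y z v.val) (seq₃ x y z (v.val + 1))).obj n
  | 0 => f
  | 1 => g

/-- The composition of operations with one input and one output, given by the linear graphs with
two vertices. -/
def comp₁ (P : SGrProp.{u} s) (x y z : P.Color) : P.hom₁ x y ⊗ P.hom₁ y z ⟶ P.hom₁ x z :=
  { app := fun n => ↾ fun p => P.pair p.1 p.2
    naturality := fun _ _ _ => by
      ext p
      refine funext fun v => ?_
      match v with
      | 0 => rfl
      | 1 => rfl } ≫
    P.comp (linear 2 (seq₃ x y z)) (mem_linear s _ _)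

theorem comp_linear_two (P : SGrProp.{u} s) (x : ℕ → P.Color) (n : SimplexCategoryᵒᵖ)
    (p : ∀ v : Fin 2, (P.hom₁ (x v.val) (x (v.val + 1))).obj n) :
    (P.comp (linear 2 x) (mem_linear s _ _)).app n p =
      (P.comp₁ (x 0) (x 1) (x 2)).app n (p 0, p 1) := by
  refine P.comp_congr (V := Fin 2) (G := linear 2 x) (G' := linear 2 (seq₃ (x 0) (x 1) (x 2)))
    (funext fun v => ?_) (funext fun v => ?_) HEq.rfl _ _ n p (P.pair (p 0) (p 1)) fun v => ?_
  · match v with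
    | 0 => rfl
    | 1 => rfl
  · match v with
    | 0 => rfl
    | 1 => rfl
  · match v with
    | 0 => rfl
    | 1 => rfl

theorem comp_linear_zero (P : SGrProp.{u} s) (x : ℕ → P.Color) (n : SimplexCategoryᵒᵖ)
    (p : ∀ v : Fin 0, (P.hom₁ (x v.val) (x (v.val + 1))).obj n) :
    (P.comp (linear 0 x) (mem_linear s _ _)).app n p = (P.unit (x 0)).app n PUnit.unit :=
  P.comp_congr (V := Fin 0) (G := linear 0 x) (G' := linear 0 fun _ => x 0)
    (funext fun v => v.elim0) (funext fun v => v.elim0) HEq.rfl _ _ n p (fun v => v.elim0)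
    fun v => v.elim0

theorem comp₁_linear_linear (P : SGrProp.{u} s) (m : ℕ → ℕ) (x : ℕ → P.Color)
    (n : SimplexCategoryᵒᵖ)
    (p : ∀ v : Fin (partialSum m 2), (P.hom₁ (x v.val) (x (v.val + 1))).obj n) :
    (P.comp₁ (x 0) (x (0 + m 0)) (x (0 + m 0 + m 1))).app n
      ((P.comp (linear (m 0) fun k => x (0 + k)) (mem_linear s _ _)).app n
        (fun w => p (blockEquiv m 2 ⟨0, w⟩)),
      (P.comp (linear (m 1) fun k => x (0 + m 0 + k)) (mem_linear s _ _)).app n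
        (fun w => p (blockEquiv m 2 ⟨1, w⟩))) =
    (P.comp (linear (partialSum m 2) x) (mem_linear s _ _)).app n p :=
  (P.comp_linear_two (fun i => x (partialSum m i)) n (fun v : Fin 2 =>
    (P.comp (linear (m v.val) fun k => x (partialSum m v.val + k)) (mem_linear s _ _)).app n
      (fun w => p (blockEquiv m 2 ⟨v, w⟩)))).symm.trans (P.comp_linear_linear m 2 x n p)

theorem unit_comp₁ (P : SGrProp.{u} s) (x y : P.Color) (n : SimplexCategoryᵒᵖ)
    (f : (P.hom₁ x y).obj n) :
    (P.comp₁ x x y).app n ((P.unit x).app n PUnit.unit, f) = f := by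
  let m : ℕ → ℕ
    | 0 => 0
    | _ => 1
  let c : ℕ → P.Color := seq₃ x y y
  let p : ∀ v : Fin 1, (P.hom₁ (c v.val) (c (v.val + 1))).obj n
    | 0 => f
  have h := P.comp₁_linear_linear m c n p
  refine Eq.trans (congrArg ((P.comp₁ x x y).app n) (Prod.ext ?_ ?_))
    (h.trans (P.comp_linear_one _ n p))
  · exact (P.comp_linear_zero (fun k => c (0 + k)) n fun w => p (blockEquiv m 2 ⟨0, w⟩)).symm
  · exact (P.comp_linear_one (fun k => c (0 + 0 + k)) n fun w => p (blockEquiv m 2 ⟨1, w⟩)).symm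

theorem comp₁_unit (P : SGrProp.{u} s) (x y : P.Color) (n : SimplexCategoryᵒᵖ)
    (f : (P.hom₁ x y).obj n) :
    (P.comp₁ x y y).app n (f, (P.unit y).app n PUnit.unit) = f := by
  let m : ℕ → ℕ
    | 0 => 1
    | _ => 0
  let c : ℕ → P.Color := seq₃ x y y
  let p : ∀ v : Fin 1, (P.hom₁ (c v.val) (c (v.val + 1))).obj n
    | 0 => f
  have h := P.comp₁_linear_linear m c n p
  refine Eq.trans (congrArg ((P.comp₁ x y y).app n) (Prod.ext ?_ ?_))
    (h.trans (P.comp_linear_one _ n p))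
  · exact (P.comp_linear_one (fun k => c (0 + k)) n fun w => p (blockEquiv m 2 ⟨0, w⟩)).symm
  · exact (P.comp_linear_zero (fun k => c (0 + 1 + k)) n fun w => p (blockEquiv m 2 ⟨1, w⟩)).symm

theorem comp₁_assoc (P : SGrProp.{u} s) (x y z w : P.Color) (n : SimplexCategoryᵒᵖ)
    (f : (P.hom₁ x y).obj n) (g : (P.hom₁ y z).obj n) (h : (P.hom₁ z w).obj n) :
    (P.comp₁ x z w).app n ((P.comp₁ x y z).app n (f, g), h) =
      (P.comp₁ x y w).app n (f, (P.comp₁ y z w).app n (g, h)) := by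
  let c : ℕ → P.Color
    | 0 => x
    | 1 => y
    | 2 => z
    | _ => w
  let p : ∀ v : Fin 3, (P.hom₁ (c v.val) (c (v.val + 1))).obj n
    | 0 => f
    | 1 => g
    | 2 => h
  let m : ℕ → ℕ
    | 0 => 2
    | _ => 1
  let m' : ℕ → ℕ
    | 0 => 1
    | _ => 2
  have h1 := P.comp₁_linear_linear m c n p
  have h2 := P.comp₁_linear_linear m' c n p
  refine Eq.trans (congrArg ((P.comp₁ x z w).app n) (Prod.ext ?_ ?_))
    (h1.trans (h2.symm.trans (congrArg ((P.comp₁ x y w).app n) (Prod.ext ?_ ?_))))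
  · exact (P.comp_linear_two (fun k => c (0 + k)) n fun w => p (blockEquiv m 2 ⟨0, w⟩)).symm
  · exact (P.comp_linear_one (fun k => c (0 + 2 + k)) n fun w => p (blockEquiv m 2 ⟨1, w⟩)).symm
  · exact P.comp_linear_one (fun k => c (0 + k)) n fun w => p (blockEquiv m' 2 ⟨0, w⟩)
  · exact P.comp_linear_two (fun k => c (0 + 1 + k)) n fun w => p (blockEquiv m' 2 ⟨1, w⟩)

/-- The underlying simplicial category of a simplicial `Gr`-prop: its objects are the colours, and
its morphisms are the operations with one input and one output. -/
instance (P : SGrProp.{u} s) : EnrichedCategory SSet.{u} P.Color where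
  Hom := P.hom₁
  id := P.unit
  comp := P.comp₁
  id_comp x y := by
    ext n f
    exact P.unit_comp₁ x y n f
  comp_id x y := by
    ext n f
    exact P.comp₁_unit x y n f
  assoc x y z w := by
    ext n p
    exact P.comp₁_assoc x y z w n p.1 p.2.1 p.2.2

theorem Hom.map_unit {P Q : SGrProp.{u} s} (f : P ⟶ Q) (x : P.Color) (n : SimplexCategoryᵒᵖ) :
    (Hom.map f (.single x) (.single x)).app n ((P.unit x).app n PUnit.unit) =
      (Q.unit (Hom.color f x)).app n PUnit.unit :=
  (Hom.map_comp f (linear 0 fun _ => x) (mem_linear s _ _) n (fun v => v.elim0)).trans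
    (Q.comp_congr (V := Fin 0) (G := (linear 0 fun _ => x).mapColors (Hom.color f))
      (G' := linear 0 fun _ => Hom.color f x)
      (funext fun v => v.elim0) (funext fun v => v.elim0) HEq.rfl _ _ n _ (fun v => v.elim0)
      fun v => v.elim0)

theorem Hom.map_comp₁ {P Q : SGrProp.{u} s} (f : P ⟶ Q) (x y z : P.Color)
    (n : SimplexCategoryᵒᵖ) (a : (P.hom₁ x y).obj n) (b : (P.hom₁ y z).obj n) :
    (Hom.map f (.single x) (.single z)).app n ((P.comp₁ x y z).app n (a, b)) =
      (Q.comp₁ (Hom.color f x) (Hom.color f y) (Hom.color f z)).app n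
        ((Hom.map f (.single x) (.single y)).app n a,
          (Hom.map f (.single y) (.single z)).app n b) :=
  (Hom.map_comp f (linear 2 (seq₃ x y z)) (mem_linear s _ _) n (P.pair a b)).trans
    (Q.comp_linear_two (fun i => Hom.color f (seq₃ x y z i)) n
      (fun v => (Hom.map f (.single (seq₃ x y z v.val)) (.single (seq₃ x y z (v.val + 1)))).app n
        (P.pair a b v)))

/-- The functor that sends a simplicial `Gr`-prop to its underlying simplicial category. -/
def toSCat (s : PastingScheme) : SGrProp.{u} s ⥤ SCat.{u} where
  obj P := { Obj := P.Color }
  map f :=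
    { obj := Hom.color f
      map := fun x y => Hom.map f (.single x) (.single y)
      map_id := fun x => by
        ext n a
        exact Hom.map_unit f x n
      map_comp := fun x y z => by
        ext n p
        exact Hom.map_comp₁ f x y z n p.1 p.2 }
  map_id _ := rfl
  map_comp _ _ := rfl

/-- Forgetting compositions does not change the underlying simplicial category. -/
theorem forget_comp_toSCat (h : PastingScheme.Le.{u} s t) :
    forget h ⋙ toSCat s = toSCat t := rfl

end SGrProp

/-- Simplicial props. -/
abbrev SProp : Type (u + 1) := SGrProp.{u} .all

/-- Simplicial properads. -/
abbrev SProperad : Type (u + 1) := SGrProp.{u} .connected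

/-- Simplicial dioperads. -/
abbrev SDioperad : Type (u + 1) := SGrProp.{u} .simplyConnected

/-- The forgetful functor from simplicial props to simplicial properads. -/
def propToProperad : SProp.{u} ⥤ SProperad.{u} :=
  SGrProp.forget PastingScheme.connected_le_all

/-- The forgetful functor from simplicial properads to simplicial dioperads. -/
def properadToDioperad : SProperad.{u} ⥤ SDioperad.{u} :=
  SGrProp.forget PastingScheme.simplyConnected_le_connected

/-! ### Categorically well-behaved adjunctions -/

/-- The set of all isomorphisms of a category. -/
def Isos (C : Type u) [Category.{u} C] : Type u := Σ x y : C, x ≅ y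

/-- The map on sets of isomorphisms induced by a functor. -/
def mapIsos {C D : Type u} [Category.{u} C] [Category.{u} D] (F : C ⥤ D) : Isos C → Isos D :=
  fun f => ⟨F.obj f.1, F.obj f.2.1, F.mapIso f.2.2⟩

/-- A functor is the identity on objects: its source and its target have the same set of objects,
and every object is mapped to itself. -/
def IsIdentityOnObjects {C D : Type u} [Category.{u} C] [Category.{u} D] (F : C ⥤ D) : Prop :=
  ∃ h : C = D, ∀ x : C, F.obj x = cast h x

/-- Let `U₁ : N ⥤ SCat`. An adjunction `F₂ ⊣ U₂` between `N` and `P` (considered over `SCat` by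
means of `U₁` and `U₂ ⋙ U₁`) is categorically well-behaved if for every object `X` of `N` the
functor `π₀ U₁ X ⥤ π₀ U₁ U₂ F₂ X` that is induced by the unit of the adjunction is the identity on
objects and a bijection on the sets of isomorphisms. -/
def CategoricallyWellBehaved {N : Type*} [Category N] {P : Type*} [Category P]
    (U₁ : N ⥤ SCat.{u}) {F₂ : N ⥤ P} {U₂ : P ⥤ N} (adj : F₂ ⊣ U₂) : Prop :=
  ∀ X : N,
    IsIdentityOnObjects (pi0.map (U₁.map (adj.unit.app X))).toFunctor ∧
      Function.Bijective (mapIsos (pi0.map (U₁.map (adj.unit.app X))).toFunctor)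

end GraphProp

/-!
Both left adjoints are instances of one construction, for pasting schemes `s` and `t` such that
every graph of `s` belongs to `t`. An operation of the free extension `free hst P` of a simplicial
prop `P` over `s` is represented by a graph of `t` whose vertices are decorated by operations of
`P`. Two decorated graphs represent the same operation if they are connected by a zigzag of
contractions, where a contraction replaces `G{H_v}`, with all `H_v` in `s`, by `G`, and the
decorations of `H_v` by their composition. Operations are composed by graph substitution. So the
construction rests on the existence (`ColoredGraph.subst`), uniqueness and associativity
(`IsSubstitution.assoc`) of graph substitution. The unit of the adjunction sends an operation to the
corresponding decorated standard corolla.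

The unit is controlled by two facts about `s` and `t`, recorded in `PastingScheme.IsExtension`.

* If the graphs `H_v` belong to `s`, then `G{H_v}` belongs to `s` if and only if `G` does.
  For connected graphs this holds because a locally constant labeling of `G{H_v}` is constant on
  each connected `H_v`. For simply connected graphs it holds because the genus of connected graphs
  is additive under substitution. Consequently whether a decorated graph belongs to `s`, and if so
  the composition of its decorations, depends only on the operation that it represents. This
  defines a partial retraction `FreeOp.value` of the unit, which is compatible with simplicial
  operators and descends to connected components. So `π₀` of the unit is faithful, and its
  image on morphisms consists of the components on which the retraction is defined.
* If the composite of two operations with one input and one output is represented by a graph of `s`,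
  then so is its first factor. Hence, if `f ≫ g` is an identity, then the retraction is defined on
  `f`. So every isomorphism, together with its inverse, comes from `P`.
-/

namespace GraphProp

/-! ### Existence and uniqueness of graph substitution -/

namespace ColoredGraph

section Substitution

variable {C : Type u} {V : Type} {a b : V → Profile C} {c d : Profile C} {W : V → Type}
  {a' b' : ∀ v, W v → Profile C}

/-- There is an edge from the vertex `v` to the vertex `w`. -/
def Step (G : ColoredGraph a b c d) (v w : V) : Prop :=
  ∃ i j, G.wire (.inr ⟨v, i⟩) = .inr ⟨w, j⟩

theorem wellFounded_step [Finite V] (G : ColoredGraph a b c d) :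
    WellFounded (Relation.TransGen G.Step) :=
  haveI : Std.Irrefl (Relation.TransGen G.Step) := ⟨G.acyclic⟩
  Finite.wellFounded_of_trans_of_irrefl _

theorem wellFounded_step_swap [Finite V] (G : ColoredGraph a b c d) :
    WellFounded fun v w => Relation.TransGen G.Step w v :=
  haveI : Std.Irrefl fun v w => Relation.TransGen G.Step w v := ⟨G.acyclic⟩
  haveI : IsTrans V fun v w => Relation.TransGen G.Step w v := ⟨fun _ _ _ h h' => h'.trans h⟩
  Finite.wellFounded_of_trans_of_irrefl _

variable {G : ColoredGraph a b c d} {H : ∀ v, ColoredGraph (a' v) (b' v) (a v) (b v)}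

theorem Reaches.unique {e : Ends c b} {t t' : Ends d (fun x : Σ v, W v => a' x.1 x.2)}
    (h : Reaches G H e t) (h' : Reaches G H e t') : t = t' := by
  induction h with
  | exit h1 =>
    cases h' with
    | exit h2 => cases h1.symm.trans h2; rfl
    | enter h2 => cases h1.symm.trans h2
    | pass h2 => cases h1.symm.trans h2
  | enter h1 h3 =>
    cases h' with
    | exit h2 => cases h1.symm.trans h2
    | enter h2 h4 =>
      cases h1.symm.trans h2
      cases h3.symm.trans h4
      rfl
    | pass h2 h4 =>
      cases h1.symm.trans h2
      cases h3.symm.trans h4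
  | pass h1 h3 _ ih =>
    cases h' with
    | exit h2 => cases h1.symm.trans h2
    | enter h2 h4 =>
      cases h1.symm.trans h2
      cases h3.symm.trans h4
    | pass h2 h4 h5 =>
      cases h1.symm.trans h2
      cases h3.symm.trans h4
      exact ih h5

variable (G H) in
/-- Following an edge of `G` through the substituted graphs ends somewhere because `G` is finite
and has no directed cycles. -/
theorem exists_reaches [Finite V] (e : Ends c b) : ∃ t, Reaches G H e t := by
  have key : ∀ v j e, (∀ i, ∃ t, Reaches G H (.inr ⟨v, i⟩) t) → G.wire e = .inr ⟨v, j⟩ →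
      ∃ t, Reaches G H e t := by
    intro v j e ih h
    rcases h1 : (H v).wire (.inl j) with i | ⟨w, k⟩
    · obtain ⟨t, ht⟩ := ih i
      exact ⟨t, .pass h h1 ht⟩
    · exact ⟨_, .enter h h1⟩
  have main : ∀ v i, ∃ t, Reaches G H (.inr ⟨v, i⟩) t := by
    intro v
    induction v using G.wellFounded_step_swap.induction with
    | _ v ih =>
      intro i
      rcases h : G.wire (.inr ⟨v, i⟩) with o | ⟨w, j⟩
      · exact ⟨_, .exit h⟩
      · exact key w j _ (ih w (.single ⟨i, j, h⟩)) h
  rcases h : G.wire e with o | ⟨w, j⟩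
  · exact ⟨_, .exit h⟩
  · exact key w j _ (main w) h

theorem Reaches.endColor_eq {e : Ends c b} {t : Ends d (fun x : Σ v, W v => a' x.1 x.2)}
    (h : Reaches G H e t) : endColor d (fun x : Σ v, W v => a' x.1 x.2) t = endColor c b e := by
  induction h with
  | @exit e o h1 =>
    rw [← G.color_wire, h1]; rfl
  | @enter e v j w k h1 h2 =>
    rw [← G.color_wire, h1]
    exact (congrArg _ h2.symm).trans ((H v).color_wire (.inl j))
  | @pass e v j i t h1 h2 _ ih =>
    rw [ih, ← G.color_wire e, h1]
    exact (congrArg _ h2.symm).trans ((H v).color_wire (.inl j))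

theorem Reaches.step {v i t} (h : Reaches G H (.inr ⟨v, i⟩) t) {v' w' k'}
    (ht : t = .inr ⟨⟨v', w'⟩, k'⟩) : Relation.TransGen G.Step v v' := by
  generalize he : (Sum.inr ⟨v, i⟩ : Ends c b) = e at h
  induction h generalizing v i with
  | exit => cases ht
  | enter h1 h2 => cases ht; cases he; exact .single ⟨_, _, h1⟩
  | pass h1 h2 _ ih => cases he; exact .head ⟨_, _, h1⟩ (ih ht rfl)

variable (G H) in
/-- `Starts G H x e` says that in the graph obtained by substituting every `H v` for `v`, the edge
that starts at `x` runs through the edge `e` of `G`. -/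
inductive Starts : Ends c (fun x : Σ v, W v => b' x.1 x.2) → Ends c b → Prop
  | input (i) : Starts (.inl i) (.inl i)
  | leave {v w k i} : (H v).wire (.inr ⟨w, k⟩) = .inl i → Starts (.inr ⟨⟨v, w⟩, k⟩) (.inr ⟨v, i⟩)
  | pass {x e v j i} : Starts x e → G.wire e = .inr ⟨v, j⟩ → (H v).wire (.inl j) = .inl i →
      Starts x (.inr ⟨v, i⟩)

variable (G H) in
theorem exists_starts [Finite V] (e : Ends c b) : ∃ x, Starts G H x e := by
  rcases e with i | ⟨v, i⟩
  · exact ⟨_, .input i⟩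
  · induction v using G.wellFounded_step.induction with
    | _ v ih =>
      rcases h : (H v).wire.symm (.inl i) with j | ⟨w, k⟩
      · have h1 := (Equiv.symm_apply_eq _).1 h
        rcases h2 : G.wire.symm (.inr ⟨v, j⟩) with o | ⟨v', i'⟩
        · exact ⟨_, .pass (.input o) ((Equiv.symm_apply_eq _).1 h2).symm h1.symm⟩
        · have h3 := ((Equiv.symm_apply_eq _).1 h2).symm
          obtain ⟨x, hx⟩ := ih v' (.single ⟨_, _, h3⟩) i'
          exact ⟨x, .pass hx h3 h1.symm⟩
      · exact ⟨_, .leave ((Equiv.symm_apply_eq _).1 h).symm⟩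

/-- The edges of a substitution that run through an edge `e` of `G` end where `e` leads to. -/
theorem IsSubstitution.wire_eq
    {K : ColoredGraph (fun x : Σ v, W v => a' x.1 x.2) (fun x : Σ v, W v => b' x.1 x.2) c d}
    (hK : IsSubstitution G H K) {x e t} (hx : Starts G H x e) (ht : Reaches G H e t) :
    K.wire x = t := by
  induction hx with
  | input i => exact (hK.input i).unique ht
  | leave h => exact (hK.outer _ _ _ _ h).unique ht
  | pass h h1 h2 ih => exact ih (.pass h1 h2 ht)

variable (G H) in
/-- The end of the edge of `G{H_v}` that starts at a given place. -/
noncomputable def substFun [Finite V] : Ends c (fun x : Σ v, W v => b' x.1 x.2) →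
    Ends d (fun x : Σ v, W v => a' x.1 x.2)
  | .inl i => (exists_reaches G H (.inl i)).choose
  | .inr ⟨⟨v, w⟩, k⟩ =>
    match (H v).wire (.inr ⟨w, k⟩) with
    | .inl i => (exists_reaches G H (.inr ⟨v, i⟩)).choose
    | .inr ⟨w', k'⟩ => .inr ⟨⟨v, w'⟩, k'⟩

theorem substFun_input [Finite V] (i) : Reaches G H (.inl i) (substFun G H (.inl i)) :=
  (exists_reaches G H (.inl i)).choose_spec

theorem substFun_outer [Finite V] {v w k i} (h : (H v).wire (.inr ⟨w, k⟩) = .inl i) :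
    Reaches G H (.inr ⟨v, i⟩) (substFun G H (.inr ⟨⟨v, w⟩, k⟩)) := by
  rw [substFun, h]
  exact (exists_reaches G H (.inr ⟨v, i⟩)).choose_spec

theorem substFun_inner [Finite V] {v w k w' k'}
    (h : (H v).wire (.inr ⟨w, k⟩) = .inr ⟨w', k'⟩) :
    substFun G H (.inr ⟨⟨v, w⟩, k⟩) = .inr ⟨⟨v, w'⟩, k'⟩ := by
  rw [substFun, h]

theorem substFun_eq [Finite V] {x e t} (hx : Starts G H x e) (ht : Reaches G H e t) :
    substFun G H x = t := by
  induction hx with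
  | input i => exact (substFun_input i).unique ht
  | leave h => exact (substFun_outer h).unique ht
  | pass h h1 h2 ih => exact ih (.pass h1 h2 ht)

variable (G H) in
theorem substFun_surjective [Finite V] : Function.Surjective (substFun G H) := by
  rintro (o | ⟨⟨v, w⟩, k⟩)
  · obtain ⟨x, hx⟩ := exists_starts G H (G.wire.symm (.inl o))
    exact ⟨x, substFun_eq hx (.exit (Equiv.apply_symm_apply _ _))⟩
  · rcases h : (H v).wire.symm (.inr ⟨w, k⟩) with j | ⟨w', k'⟩
    · obtain ⟨x, hx⟩ := exists_starts G H (G.wire.symm (.inr ⟨v, j⟩))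
      exact ⟨x, substFun_eq hx (.enter (Equiv.apply_symm_apply _ _)
        ((Equiv.symm_apply_eq _).1 h).symm)⟩
    · exact ⟨_, substFun_inner ((Equiv.symm_apply_eq _).1 h).symm⟩

theorem card_ends [Fintype V] (c : Profile C) (b : V → Profile C) :
    Fintype.card (Ends c b) = c.length + ∑ v, (b v).length := by
  simp [Fintype.card_sum, Fintype.card_sigma]

theorem card_balance [Fintype V] (G : ColoredGraph a b c d) :
    c.length + ∑ v, (b v).length = d.length + ∑ v, (a v).length := by
  rw [← card_ends, ← card_ends]
  exact Fintype.card_congr G.wire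

variable (G H) in
theorem substFun_bijective [Finite V] [∀ v, Finite (W v)] :
    Function.Bijective (substFun G H) := by
  have := Fintype.ofFinite V
  have := fun v => Fintype.ofFinite (W v)
  refine (Fintype.bijective_iff_surjective_and_card _).2 ⟨substFun_surjective G H, ?_⟩
  rw [card_ends, card_ends, Fintype.sum_sigma, Fintype.sum_sigma]
  have h1 := card_balance G
  have h2 := Finset.sum_congr (rfl : (Finset.univ : Finset V) = _) fun v _ => card_balance (H v)
  simp only [Finset.sum_add_distrib] at h2
  dsimp only
  omega

variable (G H) in
/-- The graph substitution `G{H_v}`. -/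
noncomputable def subst [Finite V] [∀ v, Finite (W v)] :
    ColoredGraph (fun x : Σ v, W v => a' x.1 x.2) (fun x : Σ v, W v => b' x.1 x.2) c d where
  wire := Equiv.ofBijective _ (substFun_bijective G H)
  color_wire e := by
    change endColor _ _ (substFun G H e) = _
    rcases e with i | ⟨⟨v, w⟩, k⟩
    · exact (substFun_input i).endColor_eq
    · rcases h : (H v).wire (.inr ⟨w, k⟩) with i | ⟨w', k'⟩
      · refine (substFun_outer h).endColor_eq.trans ?_
        exact (congrArg (endColor _ _) h.symm).trans ((H v).color_wire _)
      · rw [substFun_inner h]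
        exact (congrArg (endColor _ _) h.symm).trans ((H v).color_wire _)
  acyclic := by
    -- An edge of the composite graph stays inside one `H v` or moves forward in `G`.
    have key : ∀ x y : Σ v, W v, Relation.TransGen (fun x y : Σ v, W v => ∃ i j,
        substFun G H (.inr ⟨x, i⟩) = .inr ⟨y, j⟩) x y →
        Relation.TransGen G.Step x.1 y.1 ∨
          ∃ v w w', x = ⟨v, w⟩ ∧ y = ⟨v, w'⟩ ∧ Relation.TransGen (H v).Step w w' := by
      have step : ∀ x y : Σ v, W v, (∃ i j, substFun G H (.inr ⟨x, i⟩) = .inr ⟨y, j⟩) →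
          Relation.TransGen G.Step x.1 y.1 ∨
            ∃ v w w', x = ⟨v, w⟩ ∧ y = ⟨v, w'⟩ ∧ (H v).Step w w' := by
        rintro ⟨v, w⟩ ⟨v', w'⟩ ⟨i, j, h⟩
        rcases h1 : (H v).wire (.inr ⟨w, i⟩) with o | ⟨w'', k'⟩
        · exact .inl ((substFun_outer h1).step h)
        · rw [substFun_inner h1] at h
          cases h
          exact .inr ⟨v, w, _, rfl, rfl, _, _, h1⟩
      intro x y h
      induction h with
      | single h =>
        exact (step _ _ h).imp_right fun ⟨v, w, w', h1, h2, h3⟩ =>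
          ⟨v, w, w', h1, h2, .single h3⟩
      | tail _ h ih =>
        rcases step _ _ h with hs | ⟨v, w, w', rfl, rfl, hs⟩
        · rcases ih with h' | ⟨v, w, w', rfl, rfl, h'⟩
          · exact .inl (h'.trans hs)
          · exact .inl hs
        · rcases ih with h' | ⟨v, w, w', rfl, h1, h'⟩
          · exact .inl h'
          · cases h1
            exact .inr ⟨_, _, _, rfl, rfl, h'.tail hs⟩
    intro x h
    rcases key x x h with h | ⟨v, w, w', rfl, h1, h⟩
    · exact G.acyclic _ h
    · cases h1
      exact (H v).acyclic _ h

variable (G H) in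
theorem isSubstitution_subst [Finite V] [∀ v, Finite (W v)] : IsSubstitution G H (subst G H) where
  input := substFun_input
  inner _ _ _ _ _ h := substFun_inner h
  outer _ _ _ _ h := substFun_outer h

theorem IsSubstitution.unique
    {K K' : ColoredGraph (fun x : Σ v, W v => a' x.1 x.2) (fun x : Σ v, W v => b' x.1 x.2) c d}
    (h : IsSubstitution G H K) (h' : IsSubstitution G H K') : K = K' := by
  refine ColoredGraph.ext (Equiv.ext ?_)
  rintro (i | ⟨⟨v, w⟩, k⟩)
  · exact (h.input i).unique (h'.input i)
  · rcases h1 : (H v).wire (.inr ⟨w, k⟩) with i | ⟨w', k'⟩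
    · exact (h.outer _ _ _ _ h1).unique (h'.outer _ _ _ _ h1)
    · rw [h.inner _ _ _ _ _ h1, h'.inner _ _ _ _ _ h1]

end Substitution

end ColoredGraph

/-! ### Renaming of vertices and associativity of substitution -/

namespace ColoredGraph

section Reindex

variable {C : Type u} {V V' V'' : Type} {a b : V → Profile C} {c d : Profile C}

/-- The map of ends induced by a map of vertices that preserves profiles. -/
abbrev mapEnds (f : V' → V) (e : Ends c (b ∘ f)) : Ends c b :=
  Sum.map id (fun p : Σ v, Fin (b (f v)).length => (⟨f p.1, p.2⟩ : Σ v, Fin (b v).length)) e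

theorem mapEnds_injective (σ : V' ≃ V) :
    Function.Injective (mapEnds (c := c) (b := b) σ) := by
  rintro (i | ⟨v, i⟩) (j | ⟨w, j⟩) h
  · cases h; rfl
  · cases h
  · cases h
  · have h1 : (⟨σ v, i⟩ : Σ v, Fin (b v).length) = ⟨σ w, j⟩ := Sum.inr_injective h
    obtain rfl : v = w := σ.injective (congrArg Sigma.fst h1)
    cases h1
    rfl

theorem reindex_wire (σ : V' ≃ V) (G : ColoredGraph a b c d) (e : Ends c (b ∘ σ)) :
    mapEnds σ ((G.reindex σ).wire e) = G.wire (mapEnds σ e) :=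
  reindex_isStrictIso σ G e

theorem reindex_wire_eq_iff (σ : V' ≃ V) (G : ColoredGraph a b c d) (e : Ends c (b ∘ σ))
    (t : Ends d (a ∘ σ)) : (G.reindex σ).wire e = t ↔ G.wire (mapEnds σ e) = mapEnds σ t := by
  rw [← reindex_wire, (mapEnds_injective σ).eq_iff]

theorem IsStrictIso.eq_reindex {σ : V' ≃ V} {G' : ColoredGraph (a ∘ σ) (b ∘ σ) c d}
    {G : ColoredGraph a b c d} (h : IsStrictIso σ G' G) : G' = G.reindex σ :=
  ColoredGraph.ext (Equiv.ext fun e =>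
    ((reindex_wire_eq_iff σ G e (G'.wire e)).2 (h e).symm).symm)

theorem reindex_reindex (σ : V' ≃ V) (τ : V'' ≃ V') (G : ColoredGraph a b c d) :
    (G.reindex σ).reindex τ = G.reindex (τ.trans σ) := by
  refine ColoredGraph.ext (Equiv.ext fun e => ?_)
  rw [reindex_wire_eq_iff, reindex_wire_eq_iff]
  have h : ∀ (c : Profile C) (b : V → Profile C) (e : Ends c ((b ∘ σ) ∘ τ)),
      mapEnds (b := b) σ (mapEnds (b := b ∘ σ) τ e) = mapEnds (b := b) (τ.trans σ) e := by
    rintro c b (i | p) <;> rfl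
  exact (congrArg G.wire (h _ _ e)).trans ((reindex_wire (τ.trans σ) G e).symm.trans (h _ _ _).symm)

theorem reindex_refl (G : ColoredGraph a b c d) : G.reindex (Equiv.refl V) = G := by
  refine ColoredGraph.ext (Equiv.ext fun e => ?_)
  rw [reindex_wire_eq_iff]
  have h : ∀ (c : Profile C) (b : V → Profile C) (e : Ends c b),
      mapEnds (b := b) (Equiv.refl V) e = e := by
    rintro c b (i | p) <;> rfl
  exact (congrArg G.wire (h _ _ e)).trans (h _ _ _).symm

/-- The incidence graph does not depend on the names of the vertices. -/
def incidenceReindex (σ : V' ≃ V) (G : ColoredGraph a b c d) :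
    (G.reindex σ).incidence ≃g G.incidence where
  toEquiv := σ.sumCongr
    ((Equiv.refl _).sumCongr (Equiv.sigmaCongrLeft (β := fun v => Fin (b v).length) σ))
  map_rel_iff' := by
    have ht : ∀ v e, G.Touches (σ v) (((Equiv.refl _).sumCongr
        (Equiv.sigmaCongrLeft (β := fun v => Fin (b v).length) σ)) e) ↔
        (G.reindex σ).Touches v e := by
      intro v e
      refine or_congr (exists_congr fun i => ?_) (exists_congr fun i => ?_)
      · exact Equiv.apply_eq_iff_eq ((Equiv.refl _).sumCongr
          (Equiv.sigmaCongrLeft (β := fun v => Fin (b v).length) σ)) (x := e) (y := .inr ⟨v, i⟩)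
      · exact (Equiv.symm_apply_eq ((Equiv.refl _).sumCongr
          (Equiv.sigmaCongrLeft (β := fun v => Fin (a v).length) σ))
            (y := .inr ⟨v, i⟩)).symm
    rintro (v | e) (w | e')
    · exact Iff.rfl
    · exact ht v e'
    · exact ht w e
    · exact Iff.rfl

end Reindex

section Substitution

variable {C : Type u} {V : Type} {a b : V → Profile C} {c d : Profile C} {W : V → Type}
  {a' b' : ∀ v, W v → Profile C} {G : ColoredGraph a b c d}
  {H : ∀ v, ColoredGraph (a' v) (b' v) (a v) (b v)}
  {K : ColoredGraph (fun x : Σ v, W v => a' x.1 x.2) (fun x : Σ v, W v => b' x.1 x.2) c d}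

theorem Reaches.reindex_right {W' : V → Type} (σ : ∀ v, W' v ≃ W v) {e t t'}
    (h : Reaches G H e t) (ht : t = mapEnds (Equiv.sigmaCongrRight σ) t') :
    Reaches G (fun v => (H v).reindex (σ v)) e t' := by
  induction h with
  | exit h =>
    rcases t' with o | ⟨⟨v, w⟩, k⟩
    · cases ht
      exact .exit h
    · cases ht
  | enter h h1 =>
    rcases t' with o | ⟨⟨v, w⟩, k⟩
    · cases ht
    · cases ht
      exact .enter h ((reindex_wire_eq_iff _ _ _ _).2 h1)
  | pass h h1 _ ih => exact .pass h ((reindex_wire_eq_iff _ _ _ _).2 h1) (ih ht)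

/-- Renaming the vertices of the graphs that are substituted. -/
theorem IsSubstitution.reindex_right (h : IsSubstitution G H K) {W' : V → Type}
    (σ : ∀ v, W' v ≃ W v) : IsSubstitution G (fun v => (H v).reindex (σ v))
      (K.reindex (Equiv.sigmaCongrRight σ)) where
  input i := (h.input i).reindex_right σ (reindex_wire _ K (.inl i)).symm
  inner v w k w' k' h1 :=
    (reindex_wire_eq_iff (Equiv.sigmaCongrRight σ) K (.inr ⟨⟨v, w⟩, k⟩) (.inr ⟨⟨v, w'⟩, k'⟩)).2
      (h.inner _ _ _ _ _ ((reindex_wire_eq_iff (σ v) (H v) _ _).1 h1))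
  outer v w k _ h1 :=
    (h.outer _ _ _ _ ((reindex_wire_eq_iff (σ v) (H v) _ _).1 h1)).reindex_right σ
      (reindex_wire (Equiv.sigmaCongrRight σ) K (.inr ⟨⟨v, w⟩, k⟩)).symm

theorem Reaches.reindex_left {V' : Type} (σ : V' ≃ V) {e t e' t'}
    (h : Reaches G H e t) (he : e = mapEnds σ e')
    (ht : t = mapEnds (Equiv.sigmaCongrLeft (β := W) σ) t') :
    Reaches (G.reindex σ) (fun v => H (σ v)) e' t' := by
  induction h generalizing e' with
  | exit h =>
    rcases t' with o | ⟨⟨v, w⟩, k⟩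
    · cases ht
      exact .exit ((reindex_wire_eq_iff _ _ _ _).2 (he ▸ h))
    · cases ht
  | enter h h1 =>
    rcases t' with o | ⟨⟨v, w⟩, k⟩
    · cases ht
    · cases ht
      exact .enter ((reindex_wire_eq_iff σ G e' (.inr ⟨v, _⟩)).2 (he ▸ h)) h1
  | @pass e v j i t h h1 _ ih =>
    obtain ⟨v, rfl⟩ := σ.surjective v
    exact .pass ((reindex_wire_eq_iff σ G e' (.inr ⟨v, j⟩)).2 (he ▸ h)) h1
      (ih (e' := .inr ⟨v, i⟩) rfl ht)

/-- Renaming the vertices of the graph into which graphs are substituted. -/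
theorem IsSubstitution.reindex_left (h : IsSubstitution G H K) {V' : Type} (σ : V' ≃ V) :
    IsSubstitution (G.reindex σ) (fun v => H (σ v))
      (K.reindex (Equiv.sigmaCongrLeft (β := W) σ)) where
  input i := (h.input i).reindex_left σ rfl (reindex_wire _ K (.inl i)).symm
  inner v w k w' k' h1 :=
    (reindex_wire_eq_iff (Equiv.sigmaCongrLeft (β := W) σ) K (.inr ⟨⟨v, w⟩, k⟩)
      (.inr ⟨⟨v, w'⟩, k'⟩)).2 (h.inner _ _ _ _ _ h1)
  outer v w k i h1 := (h.outer _ _ _ _ h1).reindex_left σ (e' := .inr ⟨v, i⟩) rfl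
    (reindex_wire (Equiv.sigmaCongrLeft (β := W) σ) K (.inr ⟨⟨v, w⟩, k⟩)).symm

variable (G) in
/-- Substituting standard corollas does nothing. -/
theorem isSubstitution_corolla_right :
    IsSubstitution G (fun v => corolla (a v) (b v))
      (G.reindex (Equiv.sigmaUnique V fun _ => Unit)) := by
  have key : ∀ e t, G.wire e = mapEnds (Equiv.sigmaUnique V fun _ => Unit) t →
      Reaches G (fun v => corolla (a v) (b v)) e t := by
    rintro e (o | ⟨⟨v, w⟩, k⟩) h
    · exact .exit h
    · exact .enter h rfl
  refine ⟨fun i => key _ _ (reindex_wire _ G (.inl i)).symm, ?_, ?_⟩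
  · rintro v w k w' k' h
    cases h
  · rintro v w k i h
    cases h
    exact key _ _ (reindex_wire (Equiv.sigmaUnique V fun _ => Unit) G (.inr ⟨⟨v, w⟩, k⟩)).symm

/-- Forgetting the only element of a type. -/
def unitSigma (V : Type) : (Σ _ : Unit, V) ≃ V :=
  (Equiv.sigmaEquivProd Unit V).trans (Equiv.punitProd V)

variable (G) in
/-- Substituting a graph into the standard corolla does nothing. -/
theorem isSubstitution_corolla_left :
    IsSubstitution (corolla c d) (fun _ => G) (G.reindex (unitSigma V)) := by
  have key : ∀ i t, G.wire (.inl i) = mapEnds (unitSigma V) t →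
      Reaches (corolla c d) (fun _ => G) (.inl i) t := by
    rintro i (o | ⟨⟨v, w⟩, k⟩) h
    · exact .pass (v := ()) (j := i) (i := o) rfl h (.exit rfl)
    · exact .enter (H := fun _ => G) (v := ()) (j := i) (w := w) (k := k) rfl h
  refine ⟨fun i => key i _ (reindex_wire (unitSigma V) G (.inl i)).symm, ?_, ?_⟩
  · rintro v w k w' k' h
    exact (reindex_wire_eq_iff (unitSigma V) G (.inr ⟨⟨v, w⟩, k⟩) (.inr ⟨⟨v, w'⟩, k'⟩)).2 h
  · rintro v w k i h
    have h1 : (G.reindex (unitSigma V)).wire (.inr ⟨⟨v, w⟩, k⟩) = .inl i :=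
      (reindex_wire_eq_iff (unitSigma V) G (.inr ⟨⟨v, w⟩, k⟩) (.inl i)).2 h
    exact h1 ▸ .exit rfl

theorem Reaches.mapColors {D : Type u} (f : C → D) {e t} (h : Reaches G H e t) :
    Reaches (G.mapColors f) (fun v => (H v).mapColors f) e t := by
  induction h with
  | exit h => exact .exit h
  | enter h h1 => exact .enter h h1
  | pass h h1 _ ih => exact .pass h h1 ih

theorem IsSubstitution.mapColors (h : IsSubstitution G H K) {D : Type u} (f : C → D) :
    IsSubstitution (G.mapColors f) (fun v => (H v).mapColors f) (K.mapColors f) where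
  input i := (h.input i).mapColors f
  inner := h.inner
  outer v w k i h1 := (h.outer v w k i h1).mapColors f

variable {U : ∀ v, W v → Type} {a'' b'' : ∀ v w, U v w → Profile C}
  {J : ∀ v w, ColoredGraph (a'' v w) (b'' v w) (a' v w) (b' v w)}
  {L : ∀ v, ColoredGraph (fun x : Σ w, U v w => a'' v x.1 x.2) (fun x => b'' v x.1 x.2)
    (a v) (b v)}
  {N : ColoredGraph (fun x : Σ v, Σ w, U v w => a'' x.1 x.2.1 x.2.2)
    (fun x => b'' x.1 x.2.1 x.2.2) c d}

variable (G H) in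
/-- The edge of the substitution that starts at `x` runs through the edge `y` of `H v`. -/
def Runs (x : Ends c (fun x : Σ v, W v => b' x.1 x.2)) (v : V) : Ends (a v) (b' v) → Prop
  | .inl j => ∃ e, Starts G H x e ∧ G.wire e = .inr ⟨v, j⟩
  | .inr p => x = .inr ⟨⟨v, p.1⟩, p.2⟩

theorem Runs.starts {x v y i} (h : Runs G H x v y) (hy : (H v).wire y = .inl i) :
    Starts G H x (.inr ⟨v, i⟩) := by
  rcases y with j | ⟨w, k⟩
  · obtain ⟨e, h1, h2⟩ := h
    exact h1.pass h2 hy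
  · cases h
    exact .leave hy

theorem Runs.wire_eq {x v y w k} (h : Runs G H x v y) (hK : IsSubstitution G H K)
    (hy : (H v).wire y = .inr ⟨w, k⟩) : K.wire x = .inr ⟨⟨v, w⟩, k⟩ := by
  rcases y with j | ⟨w, k⟩
  · obtain ⟨e, h1, h2⟩ := h
    exact hK.wire_eq h1 (.enter h2 hy)
  · cases h
    exact hK.inner _ _ _ _ _ hy

theorem Runs.reaches {x v y s} (h : Runs G H x v y) (hK : IsSubstitution G H K)
    (hs : Reaches (H v) (J v) y s) :
    (∀ w u l, s = .inr ⟨⟨w, u⟩, l⟩ →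
      Reaches K (fun x : Σ v, W v => J x.1 x.2) x (.inr ⟨⟨⟨v, w⟩, u⟩, l⟩)) ∧
    (∀ i t, s = .inl i →
      (∀ x', Starts G H x' (.inr ⟨v, i⟩) → Reaches K (fun x : Σ v, W v => J x.1 x.2) x' t) →
      Reaches K (fun x : Σ v, W v => J x.1 x.2) x t) := by
  induction hs generalizing x with
  | exit hy =>
    refine ⟨fun _ _ _ h1 => by (cases h1), fun i t h1 h2 => ?_⟩
    cases h1
    exact h2 _ (h.starts hy)
  | enter hy h1 =>
    refine ⟨fun _ _ _ h2 => ?_, fun i t h1 h2 => by (cases h1)⟩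
    cases h2
    exact .enter (G := K) (H := fun x : Σ v, W v => J x.1 x.2) (v := (⟨v, _⟩ : Σ v, W v))
      (h.wire_eq hK hy) h1
  | @pass y w j i s hy h1 _ ih =>
    have ih := ih (x := .inr ⟨⟨v, w⟩, i⟩) rfl
    have h4 := h.wire_eq hK hy
    exact ⟨fun w' u l h2 => .pass (H := fun x : Σ v, W v => J x.1 x.2) h4 h1 (ih.1 w' u l h2),
      fun i t h2 h3 => .pass (H := fun x : Σ v, W v => J x.1 x.2) h4 h1 (ih.2 i t h2 h3)⟩

theorem Reaches.assoc (hK : IsSubstitution G H K)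
    (hL : ∀ v, IsSubstitution (H v) (J v) (L v)) {e t}
    (h : Reaches (W := fun v => Σ w, U v w) (a' := fun v x => a'' v x.1 x.2)
      (b' := fun v x => b'' v x.1 x.2) G L e t)
    {t' : Ends d (fun x : Σ x : Σ v, W v, U x.1 x.2 => a'' x.1.1 x.1.2 x.2)}
    (ht : t = mapEnds (Equiv.sigmaAssoc U) t') {x} (hx : Starts G H x e) :
    Reaches K (fun x : Σ v, W v => J x.1 x.2) x t' := by
  revert x
  refine Reaches.rec (W := fun v => Σ w, U v w) (a' := fun v x => a'' v x.1 x.2)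
    (b' := fun v x => b'' v x.1 x.2) (motive := fun e t _ =>
      t = mapEnds (Equiv.sigmaAssoc U) t' → ∀ {x}, Starts G H x e →
        Reaches K (fun x : Σ v, W v => J x.1 x.2) x t') ?_ ?_ ?_ h ht
  · intro e o h ht x hx
    rcases t' with o | ⟨⟨⟨v, w⟩, u⟩, k⟩
    · cases ht
      exact .exit (hK.wire_eq hx (.exit h))
    · cases ht
  · intro e v j p k h h1 ht x hx
    rcases t' with o | ⟨⟨⟨v, w⟩, u⟩, k⟩
    · cases ht
    · cases ht
      have hr : Runs G H x v (.inl j) := ⟨e, hx, h⟩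
      exact (hr.reaches hK (h1 ▸ (hL v).input j)).1 _ _ _ rfl
  · intro e v j i t h h1 _ ih ht x hx
    have hr : Runs G H x v (.inl j) := ⟨e, hx, h⟩
    exact (hr.reaches hK (h1 ▸ (hL v).input j)).2 _ _ rfl fun x' hx' => ih ht hx'

/-- Graph substitution is associative. -/
theorem IsSubstitution.assoc (hK : IsSubstitution G H K)
    (hL : ∀ v, IsSubstitution (H v) (J v) (L v)) (hN : IsSubstitution G L N) :
    IsSubstitution K (fun x : Σ v, W v => J x.1 x.2) (N.reindex (Equiv.sigmaAssoc U)) where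
  input i := (hN.input i).assoc hK hL (reindex_wire _ N (.inl i)).symm (.input i)
  inner := by
    rintro ⟨v, w⟩ u k u' k' h
    exact (reindex_wire_eq_iff (Equiv.sigmaAssoc U) N (.inr ⟨⟨⟨v, w⟩, u⟩, k⟩)
      (.inr ⟨⟨⟨v, w⟩, u'⟩, k'⟩)).2 (hN.inner _ _ _ _ _ ((hL v).inner _ _ _ _ _ h))
  outer := by
    rintro ⟨v, w⟩ u k i h
    have h1 := (hL v).outer _ _ _ _ h
    have hr : Runs G H (.inr ⟨⟨v, w⟩, i⟩) v (.inr ⟨w, i⟩) := rfl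
    rcases hs : (L v).wire (.inr ⟨⟨w, u⟩, k⟩) with i' | ⟨⟨w', u'⟩, k'⟩
    · exact (hr.reaches hK h1).2 _ _ hs fun x' hx' => (hN.outer _ _ _ _ hs).assoc hK hL
        (reindex_wire (Equiv.sigmaAssoc U) N (.inr ⟨⟨⟨v, w⟩, u⟩, k⟩)).symm hx'
    · have h2 := (reindex_wire_eq_iff (Equiv.sigmaAssoc U) N (.inr ⟨⟨⟨v, w⟩, u⟩, k⟩)
        (.inr ⟨⟨⟨v, w'⟩, u'⟩, k'⟩)).2 (hN.inner _ _ _ _ _ hs)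
      exact h2 ▸ (hr.reaches hK h1).1 _ _ _ hs

end Substitution

end ColoredGraph

/-! ### Connectedness and genus -/

namespace ColoredGraph

section Labeling

variable {C : Type u} {V : Type} {a b : V → Profile C} {c d : Profile C}

/-- A labeling of the vertices and the edges of `G` by truth values that is constant along every
incidence. A graph is connected if and only if it is nonempty and has only constant labelings. -/
structure IsLabeling (G : ColoredGraph a b c d) (f : V → Prop) (g : Ends c b → Prop) : Prop where
  start : ∀ v i, g (.inr ⟨v, i⟩) = f v
  target : ∀ e v j, G.wire e = .inr ⟨v, j⟩ → g e = f v

theorem isConnected_iff (G : ColoredGraph a b c d) : G.IsConnected ↔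
    Nonempty (V ⊕ Ends c b) ∧
      ∀ f g, G.IsLabeling f g → ∃ z, (∀ v, f v = z) ∧ ∀ e, g e = z := by
  constructor
  · intro h
    refine ⟨h.nonempty, fun f g hl => ?_⟩
    obtain ⟨x⟩ := h.nonempty
    have key : ∀ y, G.incidence.Reachable x y → Sum.elim f g y = Sum.elim f g x := by
      intro y hy
      rw [SimpleGraph.reachable_iff_reflTransGen] at hy
      have ht : ∀ v e, G.Touches v e → g e = f v := by
        rintro v e (⟨i, rfl⟩ | ⟨j, h⟩)
        · exact hl.start v i
        · exact hl.target e v j h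
      induction hy with
      | refl => rfl
      | @tail y z _ h ih =>
        rw [← ih]
        rcases y with v | e <;> rcases z with w | e'
        · exact h.elim
        · exact ht v e' h
        · exact (ht w e h).symm
        · exact h.elim
    exact ⟨Sum.elim f g x, fun v => key (.inl v) (h.preconnected _ _),
      fun e => key (.inr e) (h.preconnected _ _)⟩
  · rintro ⟨hn, h⟩
    refine @SimpleGraph.Connected.mk _ _ (fun x y => ?_) hn
    obtain ⟨z, h1, h2⟩ := h (fun v => G.incidence.Reachable x (.inl v))
      (fun e => G.incidence.Reachable x (.inr e))
      { start := fun v i => propext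
          ⟨fun h => h.trans (SimpleGraph.Adj.reachable (.inl ⟨i, rfl⟩)),
            fun h => h.trans (SimpleGraph.Adj.reachable (.inl ⟨i, rfl⟩))⟩
        target := fun e v j he => propext
          ⟨fun h => h.trans (SimpleGraph.Adj.reachable (.inr ⟨j, he⟩)),
            fun h => h.trans (SimpleGraph.Adj.reachable (.inr ⟨j, he⟩))⟩ }
    have h3 : ∀ y, G.incidence.Reachable x y = z := by
      rintro (v | e)
      · exact h1 v
      · exact h2 e
    rw [h3 y, ← h3 x]

variable {W : V → Type} {a' b' : ∀ v, W v → Profile C} {G : ColoredGraph a b c d}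
  {H : ∀ v, ColoredGraph (a' v) (b' v) (a v) (b v)}
  {K : ColoredGraph (fun x : Σ v, W v => a' x.1 x.2) (fun x : Σ v, W v => b' x.1 x.2) c d}

/-- Compatible labelings of the edges of `G` and of the graphs `H v` can be glued to a labeling
of `G{H_v}`. -/
theorem IsSubstitution.glue_labeling (hK : IsSubstitution G H K) {g : Ends c b → Prop}
    {l : ∀ v, W v → Prop} {m : ∀ v, Ends (a v) (b' v) → Prop}
    (hl : ∀ v, (H v).IsLabeling (l v) (m v))
    (hin : ∀ e v j, G.wire e = .inr ⟨v, j⟩ → g e = m v (.inl j))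
    (hout : ∀ v y i, (H v).wire y = .inl i → g (.inr ⟨v, i⟩) = m v y) :
    ∃ g' : Ends c (fun x : Σ v, W v => b' x.1 x.2) → Prop,
      K.IsLabeling (fun x => l x.1 x.2) g' ∧ (∀ x e, Starts G H x e → g e = g' x) ∧
        ∀ v w k, g' (.inr ⟨⟨v, w⟩, k⟩) = m v (.inr ⟨w, k⟩) := by
  have hr : ∀ e t, Reaches G H e t → ∀ x k, t = .inr ⟨x, k⟩ → g e = l x.1 x.2 := by
    intro e t h
    induction h with
    | exit => intro x k h; cases h
    | enter h h1 =>
      intro x k h2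
      cases h2
      exact (hin _ _ _ h).trans ((hl _).target _ _ _ h1)
    | pass h h1 _ ih =>
      exact fun x k h2 => (hin _ _ _ h).trans ((hout _ _ _ h1).symm.trans (ih x k h2))
  refine ⟨Sum.elim (fun i => g (.inl i)) fun p => m p.1.1 (.inr ⟨p.1.2, p.2⟩), ⟨?_, ?_⟩, ?_, ?_⟩
  · rintro ⟨v, w⟩ k
    exact (hl v).start w k
  · rintro (i | ⟨⟨v, w⟩, k⟩) x j h
    · exact hr _ _ (hK.input i) _ _ h
    · rcases h1 : (H v).wire (.inr ⟨w, k⟩) with i | ⟨w', k'⟩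
      · exact (hout _ _ _ h1).symm.trans (hr _ _ (hK.outer _ _ _ _ h1) _ _ h)
      · cases (hK.inner _ _ _ _ _ h1).symm.trans h
        exact (hl v).target _ _ _ h1
  · intro x e h
    induction h with
    | input => rfl
    | leave h => exact hout _ _ _ h
    | pass _ h1 h2 ih => exact (hout _ _ _ h2).trans ((hin _ _ _ h1).symm.trans ih)
  · intro v w k
    rfl

theorem exists_runs [Finite V] (v : V) (y : Ends (a v) (b' v)) : ∃ x, Runs G H x v y := by
  rcases y with j | ⟨w, k⟩
  · obtain ⟨x, hx⟩ := exists_starts G H (G.wire.symm (.inr ⟨v, j⟩))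
    exact ⟨x, _, hx, Equiv.apply_symm_apply _ _⟩
  · exact ⟨_, rfl⟩

/-- Every labeling of `G{H_v}` arises by gluing. -/
theorem IsSubstitution.restrict_labeling [Finite V] (hK : IsSubstitution G H K)
    {f : (Σ v, W v) → Prop} {g' : Ends c (fun x : Σ v, W v => b' x.1 x.2) → Prop}
    (h : K.IsLabeling f g') :
    ∃ (g : Ends c b → Prop) (m : ∀ v, Ends (a v) (b' v) → Prop),
      (∀ v, (H v).IsLabeling (fun w => f ⟨v, w⟩) (m v)) ∧
      (∀ e v j, G.wire e = .inr ⟨v, j⟩ → g e = m v (.inl j)) ∧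
      (∀ v y i, (H v).wire y = .inl i → g (.inr ⟨v, i⟩) = m v y) ∧
      (∀ i, g' (.inl i) = g (.inl i)) ∧
      ∀ v w k, g' (.inr ⟨⟨v, w⟩, k⟩) = m v (.inr ⟨w, k⟩) := by
  -- `s e` is the place where the edge of `G{H_v}` that runs through the edge `e` of `G` starts.
  choose s hs using exists_starts G H
  have hg : ∀ x e, Starts G H x e → g' (s e) = g' x := by
    intro x e hx
    obtain ⟨t, ht⟩ := exists_reaches G H e
    exact congrArg g' (K.wire.injective ((hK.wire_eq (hs e) ht).trans (hK.wire_eq hx ht).symm))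
  let m : ∀ v, Ends (a v) (b' v) → Prop := fun v y => match y with
    | .inl j => g' (s (G.wire.symm (.inr ⟨v, j⟩)))
    | .inr p => g' (.inr ⟨⟨v, p.1⟩, p.2⟩)
  have hm : ∀ v y x, Runs G H x v y → m v y = g' x := by
    rintro v (j | ⟨w, k⟩) x hx
    · obtain ⟨e, h1, h2⟩ := hx
      obtain rfl := (Equiv.eq_symm_apply _).2 h2
      exact hg _ _ h1
    · cases hx
      rfl
  refine ⟨fun e => g' (s e), m, fun v => ⟨?_, ?_⟩, ?_, ?_, ?_, ?_⟩
  · exact fun w k => h.start ⟨v, w⟩ k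
  · intro y w k hy
    obtain ⟨x, hx⟩ := exists_runs (G := G) (H := H) v y
    exact (hm v y x hx).trans (h.target _ _ _ (hx.wire_eq hK hy))
  · intro e v j he
    obtain rfl := (Equiv.eq_symm_apply _).2 he
    rfl
  · intro v y i hy
    obtain ⟨x, hx⟩ := exists_runs (G := G) (H := H) v y
    exact (hg _ _ (hx.starts hy)).trans (hm v y x hx).symm
  · exact fun i => (hg _ _ (.input i)).symm
  · exact fun v w k => rfl

/-- A graph obtained by substituting connected graphs is connected if and only if the original
graph is connected. -/
theorem IsSubstitution.isConnected_iff [Finite V] (hK : IsSubstitution G H K)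
    (hH : ∀ v, (H v).IsConnected) : K.IsConnected ↔ G.IsConnected := by
  rw [ColoredGraph.isConnected_iff, ColoredGraph.isConnected_iff]
  constructor
  · rintro ⟨⟨x⟩, h⟩
    refine ⟨?_, fun f g hl => ?_⟩
    · rcases x with x | i | p
      · exact ⟨.inl x.1⟩
      · exact ⟨.inr (.inl i)⟩
      · exact ⟨.inl p.1.1⟩
    · have hin : ∀ e v (j : Fin (a v).length), G.wire e = .inr ⟨v, j⟩ → g e = f v := hl.target
      have hout : ∀ v (y : Ends (a v) (b' v)) i, (H v).wire y = .inl i → g (.inr ⟨v, i⟩) = f v :=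
        fun v _ i _ => hl.start v i
      obtain ⟨g', h1, h2, -⟩ := hK.glue_labeling (g := g) (l := fun v _ => f v)
        (m := fun v _ => f v) (fun v => ⟨fun _ _ => rfl, fun _ _ _ _ => rfl⟩) hin hout
      obtain ⟨z, h3, h4⟩ := h _ _ h1
      have h5 : ∀ e, g e = z := fun e => by
        obtain ⟨x, hx⟩ := exists_starts G H e
        exact (h2 x e hx).trans (h4 x)
      refine ⟨z, fun v => ?_, h5⟩
      obtain ⟨w | y⟩ := (hH v).nonempty
      · exact h3 ⟨v, w⟩
      · rcases hy : (H v).wire y with i | ⟨w, k⟩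
        · exact (hout v y i hy).symm.trans (h5 _)
        · exact h3 ⟨v, w⟩
  · rintro ⟨⟨x⟩, h⟩
    refine ⟨?_, fun f g' hl => ?_⟩
    · rcases x with v | e
      · obtain ⟨w | y⟩ := (hH v).nonempty
        · exact ⟨.inl ⟨v, w⟩⟩
        · exact ⟨.inr (exists_runs (G := G) (H := H) v y).choose⟩
      · exact ⟨.inr (exists_starts G H e).choose⟩
    · obtain ⟨g, m, h1, hin, hout, h2, h3⟩ := hK.restrict_labeling hl
      choose f' hf hm using fun v => ((ColoredGraph.isConnected_iff _).1 (hH v)).2 _ _ (h1 v)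
      obtain ⟨z, h4, h5⟩ := h f' g
        { start := fun v i => (hout v ((H v).wire.symm (.inl i)) i
            (Equiv.apply_symm_apply _ _)).trans (hm v _)
          target := fun e v j he => (hin e v j he).trans (hm v _) }
      refine ⟨z, fun x => (hf x.1 x.2).trans (h4 _), ?_⟩
      rintro (i | ⟨⟨v, w⟩, k⟩)
      · exact (h2 i).trans (h5 _)
      · exact (h3 v w k).trans ((hm v _).trans (h4 v))

/-- Suppose that all edges that end at the vertex `v₀` start at inputs of the graph and that `v₀`
has exactly one output. Then a connected graph can only be the result of a substitution if the
graph that is substituted for `v₀` is connected: a labeling of this graph extends to the whole graph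
by means of the label of the output. -/
theorem IsSubstitution.isConnected_of_first [Finite V] (hK : IsSubstitution G H K)
    (h : K.IsConnected) (v₀ : V) (hv : ∀ v i j, G.wire (.inr ⟨v, i⟩) ≠ .inr ⟨v₀, j⟩)
    (i₀ : Fin (b v₀).length) (hi : ∀ i : Fin (b v₀).length, i = i₀) : (H v₀).IsConnected := by
  classical
  refine (ColoredGraph.isConnected_iff _).2
    ⟨⟨.inr ((H v₀).wire.symm (.inl i₀))⟩, fun f m hl => ?_⟩
  set z : Prop := m ((H v₀).wire.symm (.inl i₀)) with hz
  let l' : ∀ v, W v → Prop := Function.update (fun _ _ => z) v₀ f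
  let m' : ∀ v, Ends (a v) (b' v) → Prop := Function.update (fun _ _ => z) v₀ m
  let g : Ends c b → Prop := fun e => match G.wire e with
    | .inl _ => z
    | .inr p => m' p.1 (.inl p.2)
  have hl' : l' v₀ = f := Function.update_self ..
  have hm' : m' v₀ = m := Function.update_self ..
  have hl'' : ∀ v, v ≠ v₀ → l' v = fun _ => z := fun v hv => Function.update_of_ne hv ..
  have hm'' : ∀ v, v ≠ v₀ → m' v = fun _ => z := fun v hv => Function.update_of_ne hv ..
  have hin : ∀ e v j, G.wire e = .inr ⟨v, j⟩ → g e = m' v (.inl j) := by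
    intro e v j he
    change (match G.wire e with
      | .inl _ => z
      | .inr p => m' p.1 (.inl p.2)) = _
    rw [he]
  have hg : ∀ v i, g (.inr ⟨v, i⟩) = z := by
    intro v i
    rcases he : G.wire (.inr ⟨v, i⟩) with o | ⟨w, j⟩
    · change (match G.wire (.inr ⟨v, i⟩) with
        | .inl _ => z
        | .inr p => m' p.1 (.inl p.2)) = _
      rw [he]
    · rw [hin _ _ _ he]
      have hw : w ≠ v₀ := by
        rintro rfl
        exact hv _ _ _ he
      exact congrFun (hm'' w hw) _
  obtain ⟨g', h1, h2, h3⟩ := hK.glue_labeling (g := g) (l := l') (m := m') (fun v => by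
    by_cases hvv : v = v₀
    · subst hvv
      rw [hl', hm']
      exact hl
    · rw [hl'' v hvv, hm'' v hvv]
      exact ⟨fun _ _ => rfl, fun _ _ _ _ => rfl⟩) hin (fun v y i hy => by
    rw [hg]
    by_cases hvv : v = v₀
    · subst hvv
      rw [hm', hz, (Equiv.symm_apply_eq _).2 (hi i ▸ hy).symm]
    · exact (congrFun (hm'' v hvv) _).symm)
  obtain ⟨z', h4, h5⟩ := ((ColoredGraph.isConnected_iff _).1 h).2 _ _ h1
  refine ⟨z', fun w => ?_, ?_⟩
  · rw [← hl']
    exact h4 ⟨v₀, w⟩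
  · rintro (j | ⟨w, k⟩)
    · obtain ⟨x, hx⟩ := exists_starts G H (G.wire.symm (.inr ⟨v₀, j⟩))
      rw [← hm', ← hin _ _ _ (Equiv.apply_symm_apply G.wire _), h2 x _ hx]
      exact h5 x
    · rw [← hm', ← h3]
      exact h5 _

end Labeling

section Genus

variable {C : Type u} {V : Type} {a b : V → Profile C} {c d : Profile C}

/-- Every edge of the incidence graph joins a vertex to the edge of `G` at one of its inputs or
outputs, and it does so for only one of them because `G` has no loops. -/
theorem card_edgeSet_incidence [Fintype V] (G : ColoredGraph a b c d) :
    Nat.card G.incidence.edgeSet = ∑ v, (a v).length + ∑ v, (b v).length := by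
  let φ : (Σ v, Fin (a v).length ⊕ Fin (b v).length) → Σ _ : V, Ends c b
    | ⟨v, .inl j⟩ => ⟨v, G.wire.symm (.inr ⟨v, j⟩)⟩
    | ⟨v, .inr i⟩ => ⟨v, .inr ⟨v, i⟩⟩
  let ε : (Σ _ : V, Ends c b) → Sym2 (V ⊕ Ends c b) := fun q => s(.inl q.1, .inr q.2)
  have hφ : ∀ p, G.incidence.Adj (.inl (φ p).1) (.inr (φ p).2) := by
    rintro ⟨v, j | i⟩
    · exact .inr ⟨j, Equiv.apply_symm_apply _ _⟩
    · exact .inl ⟨i, rfl⟩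
  have inj : Function.Injective φ := by
    have noloop : ∀ v i j, G.wire.symm (.inr ⟨v, j⟩) ≠ .inr ⟨v, i⟩ := fun v i j h =>
      G.acyclic v (.single ⟨i, j, ((Equiv.symm_apply_eq _).1 h).symm⟩)
    rintro ⟨v, j | i⟩ ⟨w, j' | i'⟩ h
    · obtain rfl : v = w := congrArg Sigma.fst h
      have h1 : G.wire.symm (.inr ⟨v, j⟩) = G.wire.symm (.inr ⟨v, j'⟩) :=
        eq_of_heq (Sigma.mk.inj h).2
      cases G.wire.symm.injective h1
      rfl
    · obtain rfl : v = w := congrArg Sigma.fst h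
      exact (noloop _ _ _ (eq_of_heq (Sigma.mk.inj h).2)).elim
    · obtain rfl : v = w := congrArg Sigma.fst h
      exact (noloop _ _ _ (eq_of_heq (Sigma.mk.inj h).2).symm).elim
    · obtain rfl : v = w := congrArg Sigma.fst h
      have h1 : (Sum.inr ⟨v, i⟩ : Ends c b) = .inr ⟨v, i'⟩ := eq_of_heq (Sigma.mk.inj h).2
      cases h1
      rfl
  have e := Nat.card_congr (Equiv.ofBijective
    (fun p => (⟨s(.inl (φ p).1, .inr (φ p).2), hφ p⟩ : G.incidence.edgeSet)) ⟨fun p q h => inj ?_,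
      ?_⟩)
  · rw [← e, Nat.card_eq_fintype_card]
    simp [Fintype.card_sigma, Finset.sum_add_distrib]
  · have h1 := congrArg Subtype.val h
    simp only [Sym2.eq_iff, Sum.inl.injEq, Sum.inr.injEq, reduceCtorEq, and_self, or_false] at h1
    exact Sigma.ext h1.1 (heq_of_eq h1.2)
  · have key : ∀ v e, G.Touches v e → ∃ p, φ p = ⟨v, e⟩ := by
      rintro v e (⟨i, rfl⟩ | ⟨j, h⟩)
      · exact ⟨⟨v, .inr i⟩, rfl⟩
      · exact ⟨⟨v, .inl j⟩, congrArg (Sigma.mk v) ((Equiv.symm_apply_eq _).2 h.symm)⟩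
    rintro ⟨x, hx⟩
    induction x with
    | _ x y =>
      rcases x with v | e <;> rcases y with w | e'
      · exact (show False from hx).elim
      · obtain ⟨p, hp⟩ := key v e' hx
        exact ⟨p, Subtype.ext (congrArg ε hp)⟩
      · obtain ⟨p, hp⟩ := key w e hx
        exact ⟨p, Subtype.ext ((congrArg ε hp).trans Sym2.eq_swap)⟩
      · exact (show False from hx).elim

/-- A connected graph is simply connected if and only if its Euler characteristic is one. -/
theorem isSimplyConnected_iff_card [Fintype V] (G : ColoredGraph a b c d) :
    G.IsSimplyConnected ↔
      G.IsConnected ∧ ∑ v, (a v).length + 1 = Fintype.card V + c.length := by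
  rw [IsSimplyConnected, SimpleGraph.isTree_iff_connected_and_card, card_edgeSet_incidence,
    Nat.card_eq_fintype_card, Fintype.card_sum, card_ends]
  refine and_congr_right fun _ => ?_
  omega

theorem IsConnected.card_le [Fintype V] {G : ColoredGraph a b c d} (h : G.IsConnected) :
    Fintype.card V + c.length ≤ ∑ v, (a v).length + 1 := by
  have h1 := h.card_vert_le_card_edgeSet_add_one
  rw [card_edgeSet_incidence, Nat.card_eq_fintype_card, Fintype.card_sum, card_ends] at h1
  omega

variable {W : V → Type} {a' b' : ∀ v, W v → Profile C} {G : ColoredGraph a b c d}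
  {H : ∀ v, ColoredGraph (a' v) (b' v) (a v) (b v)}
  {K : ColoredGraph (fun x : Σ v, W v => a' x.1 x.2) (fun x : Σ v, W v => b' x.1 x.2) c d}

/-- The genus is additive under substitution of connected graphs. So the result is simply connected
if and only if all graphs involved are. -/
theorem IsSubstitution.isSimplyConnected_iff [Finite V] [∀ v, Finite (W v)]
    (hK : IsSubstitution G H K) (hG : G.IsConnected) (hH : ∀ v, (H v).IsConnected) :
    K.IsSimplyConnected ↔ G.IsSimplyConnected ∧ ∀ v, (H v).IsSimplyConnected := by
  have := Fintype.ofFinite V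
  have := fun v => Fintype.ofFinite (W v)
  have hKc := (hK.isConnected_iff hH).2 hG
  have h1 := hG.card_le
  have h2 := fun v => (hH v).card_le
  have h3 := Finset.sum_le_sum fun v (_ : v ∈ (Finset.univ : Finset V)) => h2 v
  have h4 := Finset.sum_eq_sum_iff_of_le fun v (_ : v ∈ (Finset.univ : Finset V)) => h2 v
  simp only [isSimplyConnected_iff_card, hKc, hG, hH, true_and, Fintype.sum_sigma,
    Fintype.card_sigma]
  simp only [Finset.sum_add_distrib, Finset.mem_univ, true_implies, Finset.sum_const,
    Finset.card_univ, smul_eq_mul, mul_one] at h3 h4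
  constructor
  · intro h
    exact ⟨by omega, fun v => (h4.1 (by omega) v).symm⟩
  · rintro ⟨h, h'⟩
    have := h4.2 fun v => (h' v).symm
    omega

end Genus

end ColoredGraph

/-! ### The free extension of a simplicial prop to a larger pasting scheme -/

open ColoredGraph

namespace PastingScheme

theorem mem_reindex_iff {t : PastingScheme} {C : Type u} {V V' : Type} {a b : V → Profile C}
    {c d : Profile C} {G : ColoredGraph a b c d} (σ : V' ≃ V) :
    t.Mem (G.reindex σ) ↔ t.Mem G := by
  cases t
  · exact Iff.rfl
  · exact (G.incidenceReindex σ).connected_iff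
  · exact (G.incidenceReindex σ).isTree_iff

theorem Mem.reindex {t : PastingScheme} {C : Type u} {V V' : Type} {a b : V → Profile C}
    {c d : Profile C} {G : ColoredGraph a b c d} (h : t.Mem G) (σ : V' ≃ V) :
    t.Mem (G.reindex σ) :=
  (mem_reindex_iff σ).2 h

theorem mem_corolla (t : PastingScheme) {C : Type u} (c d : Profile C) : t.Mem (corolla c d) :=
  .of_isSimplyConnected t (corolla_isSimplyConnected c d)

/-- The properties of a pair of pasting schemes on which the construction of the left adjoint and
the computation of its unit depend. -/
structure IsExtension (s t : PastingScheme) : Prop where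
  le : Le.{u} s t
  /-- The larger pasting scheme is closed under substitution. -/
  subst {C : Type u} {V : Type} [Finite V] {W : V → Type} [∀ v, Finite (W v)]
    {a b : V → Profile C} {c d : Profile C} {a' b' : ∀ v, W v → Profile C}
    {G : ColoredGraph a b c d} {H : ∀ v, ColoredGraph (a' v) (b' v) (a v) (b v)}
    {K : ColoredGraph (fun x : Σ v, W v => a' x.1 x.2) (fun x : Σ v, W v => b' x.1 x.2) c d} :
    IsSubstitution G H K → t.Mem G → (∀ v, t.Mem (H v)) → t.Mem K
  /-- Substituting graphs of the smaller pasting scheme does not change whether a graph belongs to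
  the smaller pasting scheme. -/
  mem_iff {C : Type u} {V : Type} [Finite V] {W : V → Type} [∀ v, Finite (W v)]
    {a b : V → Profile C} {c d : Profile C} {a' b' : ∀ v, W v → Profile C}
    {G : ColoredGraph a b c d} {H : ∀ v, ColoredGraph (a' v) (b' v) (a v) (b v)}
    {K : ColoredGraph (fun x : Σ v, W v => a' x.1 x.2) (fun x : Σ v, W v => b' x.1 x.2) c d} :
    IsSubstitution G H K → t.Mem G → (∀ v, s.Mem (H v)) → (s.Mem K ↔ s.Mem G)
  /-- If a composite of two graphs with one input and one output belongs to the smaller pasting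
  scheme, then so does its first factor. -/
  mem_first {C : Type u} {W : Fin 2 → Type} [∀ v, Finite (W v)] {x : ℕ → C}
    {a' b' : ∀ v, W v → Profile C}
    {H : ∀ v : Fin 2, ColoredGraph (a' v) (b' v) (.single (x v.val)) (.single (x (v.val + 1)))}
    {K : ColoredGraph (fun x : Σ v, W v => a' x.1 x.2) (fun x : Σ v, W v => b' x.1 x.2)
      (.single (x 0)) (.single (x 2))} :
    IsSubstitution (linear 2 x) H K → (∀ v, t.Mem (H v)) → s.Mem K → s.Mem (H 0)

theorem isExtension_connected_all : IsExtension.{u} connected all where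
  le := connected_le_all
  subst _ _ _ := trivial
  mem_iff h _ hH := h.isConnected_iff hH
  mem_first {C W _ x a' b' H K} h _ hK := by
    refine h.isConnected_of_first hK 0 ?_ (0 : Fin 1) fun i => Subsingleton.elim (α := Fin 1) i 0
    intro v i j h1
    have h2 := linear_wire_val 2 x (.inr ⟨v, i⟩) (.inr ⟨0, j⟩) h1
    simp [linearStart, linearEnd] at h2

theorem isExtension_simplyConnected_connected : IsExtension.{u} simplyConnected connected where
  le := simplyConnected_le_connected
  subst h hG hH := (h.isConnected_iff hH).2 hG
  mem_iff h hG hH := (h.isSimplyConnected_iff hG fun v => SimpleGraph.IsTree.connected (hH v)).trans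
    (and_iff_left hH)
  mem_first h hH hK := ((h.isSimplyConnected_iff
    (SimpleGraph.IsTree.connected (linear_isSimplyConnected _ _)) hH).1 hK).2 0

end PastingScheme

open PastingScheme

/-- A function of finitely many arguments that is invariant under a simultaneous application of
reflexive relations descends to the quotients: by reflexivity, the arguments can be changed one at
a time. -/
theorem eq_of_forall_quot_eq {ι : Type*} [Finite ι] {X : ι → Type*} (r : ∀ i, X i → X i → Prop)
    (hr : ∀ i x, r i x x) {Z : Type*} (F : (∀ i, X i) → Z)
    (hF : ∀ x y, (∀ i, r i (x i) (y i)) → F x = F y) (x y : ∀ i, X i)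
    (h : ∀ i, Quot.mk (r i) (x i) = Quot.mk (r i) (y i)) : F x = F y := by
  classical
  have := Fintype.ofFinite ι
  have single : ∀ i z z', Quot.mk (r i) z = Quot.mk (r i) z' → ∀ x : ∀ i, X i,
      F (Function.update x i z) = F (Function.update x i z') := by
    intro i z z' h x
    replace h := Quot.eqvGen_exact h
    induction h with
    | rel z z' h =>
      refine hF _ _ fun j => ?_
      by_cases hj : j = i
      · subst hj
        simpa using h
      · simpa [hj] using hr j _
    | refl => rfl
    | symm z z' _ ih => exact ih.symm
    | trans z z' z'' _ _ ih ih' => exact ih.trans ih'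
  have key : ∀ S : Finset ι, F x = F (S.piecewise y x) := by
    intro S
    induction S using Finset.induction_on with
    | empty => simp
    | insert i S hi ih =>
      rw [Finset.piecewise_insert, ← single i _ _ (h i), ih]
      congr 1
      ext j
      by_cases hj : j = i
      · subst hj
        simp [hi]
      · simp [hj]
  simpa using key Finset.univ

namespace SGrProp

variable {s t : PastingScheme}

/-- A graph of the pasting scheme `t` whose vertices are decorated by operations of `P`. -/
structure Decorated (t : PastingScheme) (P : SGrProp.{u} s) (n : SimplexCategoryᵒᵖ)
    (c d : Profile P.Color) : Type (max 1 u) where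
  V : Type
  [finite : Finite V]
  a : V → Profile P.Color
  b : V → Profile P.Color
  graph : ColoredGraph a b c d
  mem : t.Mem graph
  op : ∀ v, (P.hom (a v) (b v)).obj n

attribute [instance] Decorated.finite

/-- A way of writing the decorations of `y` as compositions along graphs of the pasting scheme `s`,
together with a renaming of the vertices of the graph that arises by substituting these graphs. -/
structure Contraction {P : SGrProp.{u} s} {n : SimplexCategoryᵒᵖ} {c d : Profile P.Color}
    (y : Decorated t P n c d) : Type (max 1 u) where
  W : y.V → Type
  [finite : ∀ v, Finite (W v)]
  a : ∀ v, W v → Profile P.Color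
  b : ∀ v, W v → Profile P.Color
  H : ∀ v, ColoredGraph (a v) (b v) (y.a v) (y.b v)
  mem_H : ∀ v, s.Mem (H v)
  op : ∀ v w, (P.hom (a v w) (b v w)).obj n
  op_eq : ∀ v, y.op v = (P.comp (H v) (mem_H v)).app n (op v)
  K : ColoredGraph (fun x : Σ v, W v => a x.1 x.2) (fun x : Σ v, W v => b x.1 x.2) c d
  isSubstitution : IsSubstitution y.graph H K
  mem_K : t.Mem K
  V : Type
  σ : V ≃ Σ v, W v

attribute [instance] Contraction.finite

section

variable {P : SGrProp.{u} s} {n m : SimplexCategoryᵒᵖ} {c d : Profile P.Color}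

/-- The decorated graph from which `y` arises by a contraction. -/
def Contraction.source {y : Decorated t P n c d} (D : Contraction y) : Decorated t P n c d where
  V := D.V
  finite := .of_equiv _ D.σ.symm
  a x := D.a (D.σ x).1 (D.σ x).2
  b x := D.b (D.σ x).1 (D.σ x).2
  graph := D.K.reindex D.σ
  mem := D.mem_K.reindex D.σ
  op x := D.op (D.σ x).1 (D.σ x).2

/-- The relation that `y` arises from `x` by a contraction. -/
def Contracts (x y : Decorated t P n c d) : Prop := ∃ D : Contraction y, D.source = x

theorem Decorated.ext_graph {V : Type} [Finite V] {a b : V → Profile P.Color}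
    {G G' : ColoredGraph a b c d} (h : G = G') (hG : t.Mem G) (hG' : t.Mem G')
    (p : ∀ v, (P.hom (a v) (b v)).obj n) :
    (⟨V, a, b, G, hG, p⟩ : Decorated t P n c d) = ⟨V, a, b, G', hG', p⟩ := by
  subst h
  rfl

/-- Renaming the vertices of a decorated graph. -/
def Decorated.reindex (x : Decorated t P n c d) {V : Type} (σ : V ≃ x.V) :
    Decorated t P n c d where
  V := V
  finite := .of_equiv _ σ.symm
  a := x.a ∘ σ
  b := x.b ∘ σ
  graph := x.graph.reindex σ
  mem := x.mem.reindex σ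
  op v := x.op (σ v)

/-- Renaming the vertices is a contraction of standard corollas. -/
theorem Decorated.contracts_reindex (x : Decorated t P n c d) {V : Type} (σ : V ≃ x.V) :
    Contracts (x.reindex σ) x := by
  have : Finite V := .of_equiv _ σ.symm
  refine ⟨{
    W := fun _ => Unit
    a := fun v _ => x.a v
    b := fun v _ => x.b v
    H := fun v => corolla (x.a v) (x.b v)
    mem_H := fun v => mem_corolla s _ _
    op := fun v _ => x.op v
    op_eq := fun v => (P.comp_corolla _ _ n (x.op v)).symm
    K := _
    isSubstitution := isSubstitution_corolla_right x.graph
    mem_K := x.mem.reindex _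
    V := V
    σ := σ.trans (Equiv.sigmaUnique x.V fun _ => Unit).symm }, ?_⟩
  have h : ((x.graph.reindex (Equiv.sigmaUnique x.V fun _ => Unit)).reindex
      (σ.trans (Equiv.sigmaUnique x.V fun _ => Unit).symm) :
        ColoredGraph (x.a ∘ σ) (x.b ∘ σ) c d) = x.graph.reindex σ := reindex_reindex _ _ x.graph
  exact Decorated.ext_graph (V := V) h _ _ _

theorem Decorated.contracts_refl (x : Decorated t P n c d) : Contracts x x := by
  have h := x.contracts_reindex (Equiv.refl x.V)
  rwa [show x.reindex (Equiv.refl x.V) = x from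
    Decorated.ext_graph (V := x.V) (reindex_refl x.graph) _ _ _] at h

/-- Applying a simplicial operator to all decorations. -/
def Decorated.map (θ : n ⟶ m) (x : Decorated t P n c d) : Decorated t P m c d where
  V := x.V
  a := x.a
  b := x.b
  graph := x.graph
  mem := x.mem
  op v := (P.hom (x.a v) (x.b v)).map θ (x.op v)

theorem comp_naturality (P : SGrProp.{u} s) {V : Type} [Finite V] {a b : V → Profile P.Color}
    {c d : Profile P.Color} (G : ColoredGraph a b c d) (hG : s.Mem G) (θ : n ⟶ m)
    (p : ∀ v, (P.hom (a v) (b v)).obj n) :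
    (P.hom c d).map θ ((P.comp G hG).app n p) =
      (P.comp G hG).app m (fun v => (P.hom (a v) (b v)).map θ (p v)) :=
  (ConcreteCategory.congr_hom ((P.comp G hG).naturality θ) p).symm

/-- Applying a simplicial operator to a contraction. -/
def Contraction.map (θ : n ⟶ m) {y : Decorated t P n c d} (D : Contraction y) :
    Contraction (y.map θ) where
  W := D.W
  finite := D.finite
  a := D.a
  b := D.b
  H := D.H
  mem_H := D.mem_H
  op v w := (P.hom _ _).map θ (D.op v w)
  op_eq v :=
    haveI := D.finite v
    (congrArg _ (D.op_eq v)).trans (P.comp_naturality _ _ θ _)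
  K := D.K
  isSubstitution := D.isSubstitution
  mem_K := D.mem_K
  V := D.V
  σ := D.σ

end

section

variable (t) (P : SGrProp.{u} s) (n : SimplexCategoryᵒᵖ) (c d : Profile P.Color)

instance : Small.{u} (Quot (Contracts (t := t) (P := P) (n := n) (c := c) (d := d))) := by
  let X : Type u := Σ (k : ℕ) (a : Fin k → Profile P.Color) (b : Fin k → Profile P.Color)
    (_ : {G : ColoredGraph a b c d // t.Mem G}), ∀ v, (P.hom (a v) (b v)).obj n
  refine small_of_surjective (α := X)
    (f := fun x => Quot.mk _ ⟨Fin x.1, x.2.1, x.2.2.1, x.2.2.2.1.1, x.2.2.2.1.2, x.2.2.2.2⟩) ?_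
  rintro ⟨x⟩
  let y := x.reindex (Finite.equivFin x.V).symm
  exact ⟨⟨_, y.a, y.b, ⟨y.graph, y.mem⟩, y.op⟩, Quot.sound (x.contracts_reindex _)⟩

/-- The `n`-simplices of operations of the free extension of `P`: graphs of the pasting scheme `t`
decorated by `P`, where a subgraph belonging to `s` may be replaced by the composition of
its decorations. As the vertex sets range over all finite types in `Type`, the quotient
lives in a larger universe; it is small because the vertices can be numbered. -/
def FreeOp : Type u := Shrink.{u} (Quot (Contracts (t := t) (P := P) (n := n) (c := c) (d := d)))

end

namespace FreeOp

variable {P : SGrProp.{u} s} {n m : SimplexCategoryᵒᵖ} {c d : Profile P.Color}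

/-- The operation given by a decorated graph. -/
noncomputable def mk (x : Decorated t P n c d) : FreeOp t P n c d := equivShrink _ (Quot.mk _ x)

theorem exists_rep (f : FreeOp t P n c d) : ∃ x, mk x = f := by
  obtain ⟨x, hx⟩ := Quot.exists_rep ((equivShrink _).symm f)
  exact ⟨x, (Equiv.eq_symm_apply _).1 hx⟩

theorem sound {y : Decorated t P n c d} (D : Contraction y) : mk D.source = mk y :=
  congrArg (equivShrink _) (Quot.sound ⟨D, rfl⟩)

theorem mk_reindex (x : Decorated t P n c d) {V : Type} (σ : V ≃ x.V) :
    mk (x.reindex σ) = mk x :=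
  congrArg (equivShrink _) (Quot.sound (x.contracts_reindex σ))

/-- A function on decorated graphs that is invariant under contractions. -/
noncomputable def lift {Z : Type*} (F : Decorated t P n c d → Z)
    (hF : ∀ (y : Decorated t P n c d) (D : Contraction y), F D.source = F y)
    (f : FreeOp t P n c d) : Z :=
  Quot.lift F (by rintro _ y ⟨D, rfl⟩; exact hF y D) ((equivShrink _).symm f)

theorem lift_mk {Z : Type*} (F : Decorated t P n c d → Z)
    (hF : ∀ (y : Decorated t P n c d) (D : Contraction y), F D.source = F y)
    (x : Decorated t P n c d) : lift F hF (mk x) = F x := by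
  rw [lift, mk, Equiv.symm_apply_apply]

/-- The simplicial structure. -/
noncomputable def map (θ : n ⟶ m) : FreeOp t P n c d → FreeOp t P m c d :=
  lift (fun x => mk (x.map θ)) fun _ D => sound (D.map θ)

theorem map_mk (θ : n ⟶ m) (x : Decorated t P n c d) : map θ (mk x) = mk (x.map θ) :=
  lift_mk _ _ x

end FreeOp

section

variable {P : SGrProp.{u} s} {n m : SimplexCategoryᵒᵖ} {V : Type} [Finite V]
  {a b : V → Profile P.Color} {c d : Profile P.Color}

/-- Substituting decorated graphs into a graph. -/
noncomputable def Decorated.subst (hst : IsExtension.{u} s t) (G : ColoredGraph a b c d)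
    (hG : t.Mem G) (x : ∀ v, Decorated t P n (a v) (b v)) : Decorated t P n c d where
  V := Σ v, (x v).V
  a z := (x z.1).a z.2
  b z := (x z.1).b z.2
  graph := G.subst fun v => (x v).graph
  mem := hst.subst (isSubstitution_subst _ _) hG fun v => (x v).mem
  op z := (x z.1).op z.2

/-- Contractions of the decorated graphs that are substituted into `G` form a contraction of the
result, by associativity of substitution. -/
theorem FreeOp.mk_subst_eq_of_contraction (hst : IsExtension.{u} s t) (G : ColoredGraph a b c d)
    (hG : t.Mem G) (y : ∀ v, Decorated t P n (a v) (b v)) (D : ∀ v, Contraction (y v)) :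
    FreeOp.mk (.subst hst G hG fun v => (D v).source) = FreeOp.mk (.subst hst G hG y) := by
  have hK := isSubstitution_subst G fun v => (D v).K
  let E : Contraction (.subst hst G hG y) :=
    { W := fun z => (D z.1).W z.2
      a := fun z => (D z.1).a z.2
      b := fun z => (D z.1).b z.2
      H := fun z => (D z.1).H z.2
      mem_H := fun z => (D z.1).mem_H z.2
      op := fun z => (D z.1).op z.2
      op_eq := fun z => (D z.1).op_eq z.2
      K := _
      isSubstitution := (isSubstitution_subst G fun v => (y v).graph).assoc
        (fun v => (D v).isSubstitution) hK
      mem_K := Mem.reindex (hst.subst hK hG fun v => (D v).mem_K) _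
      V := Σ v, (D v).V
      σ := (Equiv.sigmaCongrRight fun v => (D v).σ).trans
        (Equiv.sigmaAssoc fun v w => (D v).W w).symm }
  have := fun v => (D v).source.finite
  have := fun v => Finite.of_equiv _ (D v).σ.symm
  have h0 := hK.reindex_right fun v => (D v).σ
  have h1 := (isSubstitution_subst G fun v => (D v).K.reindex (D v).σ).unique h0
  have h2 := reindex_reindex (Equiv.sigmaAssoc fun v w => (D v).W w) E.σ
    (G.subst fun v => (D v).K)
  have h : G.subst (fun v => (D v).source.graph) = E.source.graph := h1.trans h2.symm
  exact (congrArg FreeOp.mk (Decorated.ext_graph (V := Σ v, (D v).V) h _ _ _)).trans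
    (FreeOp.sound E)

namespace FreeOp

/-- The composition of operations of the free extension, defined by means of representatives. -/
noncomputable def comp (hst : IsExtension.{u} s t) (G : ColoredGraph a b c d) (hG : t.Mem G)
    (f : ∀ v, FreeOp t P n (a v) (b v)) : FreeOp t P n c d :=
  mk (.subst hst G hG fun v => (exists_rep (f v)).choose)

theorem comp_mk (hst : IsExtension.{u} s t) (G : ColoredGraph a b c d) (hG : t.Mem G)
    (x : ∀ v, Decorated t P n (a v) (b v)) :
    comp hst G hG (fun v => mk (x v)) = mk (.subst hst G hG x) := by
  have key := eq_of_forall_quot_eq (X := fun v => Decorated t P n (a v) (b v))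
    (fun _ => Contracts) (fun _ x => x.contracts_refl) (fun x => mk (.subst hst G hG x)) (by
      intro x y h
      choose D hD using h
      obtain rfl : (fun v => (D v).source) = x := funext hD
      exact mk_subst_eq_of_contraction hst G hG y D)
  exact key _ x fun v => (equivShrink _).injective (exists_rep (mk (x v))).choose_spec

/-- Replacing subgraphs by their compositions does not change an operation. -/
theorem mk_subst {W : V → Type} [∀ v, Finite (W v)]
    {a' b' : ∀ v, W v → Profile P.Color} {G : ColoredGraph a b c d}
    {H : ∀ v, ColoredGraph (a' v) (b' v) (a v) (b v)}
    {K : ColoredGraph (fun x : Σ v, W v => a' x.1 x.2) (fun x : Σ v, W v => b' x.1 x.2) c d}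
    (h : IsSubstitution G H K) (hG : t.Mem G) (hH : ∀ v, s.Mem (H v)) (hK : t.Mem K)
    (p : ∀ v w, (P.hom (a' v w) (b' v w)).obj n) :
    mk ⟨_, _, _, K, hK, fun x => p x.1 x.2⟩ =
      mk ⟨_, _, _, G, hG, fun v => (P.comp (H v) (hH v)).app n (p v)⟩ := by
  let y : Decorated t P n c d := ⟨_, _, _, G, hG, fun v => (P.comp (H v) (hH v)).app n (p v)⟩
  let D : Contraction y :=
    { W := W
      a := a'
      b := b'
      H := H
      mem_H := hH
      op := p
      op_eq := fun _ => rfl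
      K := K
      isSubstitution := h
      mem_K := hK
      V := _
      σ := .refl _ }
  refine Eq.trans ?_ (sound D)
  exact (congrArg mk (Decorated.ext_graph (V := Σ v, W v) (reindex_refl K) _ _ _)).symm

theorem map_comp (hst : IsExtension.{u} s t) (G : ColoredGraph a b c d) (hG : t.Mem G)
    (θ : n ⟶ m) (f : ∀ v, FreeOp t P n (a v) (b v)) :
    map θ (comp hst G hG f) = comp hst G hG fun v => map θ (f v) := by
  choose x hx using fun v => exists_rep (f v)
  obtain rfl : (fun v => mk (x v)) = f := funext hx
  simp only [comp_mk, map_mk]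
  rfl

end FreeOp

end

open FreeOp

/-- The free extension of `P` to a larger pasting scheme. -/
noncomputable def free (hst : IsExtension.{u} s t) (P : SGrProp.{u} s) : SGrProp.{u} t where
  Color := P.Color
  hom c d :=
    { obj := fun n => FreeOp t P n c d
      map := fun θ => ↾ FreeOp.map θ
      map_id := fun n => by
        ext f
        obtain ⟨x, rfl⟩ := exists_rep f
        refine (map_mk _ x).trans (congrArg FreeOp.mk ?_)
        simp [Decorated.map]
      map_comp := fun θ θ' => by
        ext f
        obtain ⟨x, rfl⟩ := exists_rep f
        refine (map_mk _ x).trans (Eq.trans (congrArg FreeOp.mk ?_)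
          ((congrArg (FreeOp.map θ') (map_mk θ x)).trans (map_mk θ' _)).symm)
        simp [Decorated.map]
        rfl }
  comp G hG :=
    { app := fun n => ↾ FreeOp.comp hst G hG
      naturality := fun _ _ θ => by
        ext f
        exact (FreeOp.map_comp hst G hG θ f).symm }
  comp_corolla c d n f := by
    obtain ⟨x, rfl⟩ := exists_rep f
    refine (comp_mk hst (corolla c d) _ fun _ => x).trans (Eq.trans (congrArg FreeOp.mk ?_)
      (mk_reindex x (unitSigma x.V)))
    exact Decorated.ext_graph (V := Σ _ : Unit, x.V) ((isSubstitution_subst _ _).unique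
      (isSubstitution_corolla_left x.graph)) _ _ _
  comp_iso {V V'} _ _ σ a b c d G' G hG' hG h n f := by
    obtain rfl := h.eq_reindex
    choose x hx using fun v => exists_rep (f v)
    obtain rfl : (fun v => FreeOp.mk (x v)) = f := funext hx
    refine (comp_mk hst _ hG' fun v => x (σ v)).trans (Eq.trans (congrArg FreeOp.mk ?_)
      ((mk_reindex _ (Equiv.sigmaCongrLeft (β := fun v => (x v).V) σ)).trans
        (comp_mk hst G hG x).symm))
    exact Decorated.ext_graph (V := Σ v, (x (σ v)).V) ((isSubstitution_subst _ _).unique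
      ((isSubstitution_subst G fun v => (x v).graph).reindex_left σ)) _ _ _
  comp_subst {V} _ {W} _ {a b c d a' b'} G H K hG hH hK h n f := by
    choose x hx using fun v w => exists_rep (f v w)
    obtain rfl : (fun v w => FreeOp.mk (x v w)) = f := funext fun v => funext (hx v)
    have h1 : (fun v => FreeOp.comp hst (H v) (hH v) fun w => FreeOp.mk (x v w)) =
        fun v => FreeOp.mk (.subst hst (H v) (hH v) (x v)) :=
      funext fun v => comp_mk hst (H v) (hH v) (x v)
    refine (comp_mk hst K hK fun z => x z.1 z.2).trans (Eq.trans ?_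
      ((congrArg (FreeOp.comp hst G hG) h1).trans (comp_mk hst G hG _)).symm)
    refine Eq.trans (congrArg FreeOp.mk ?_) (mk_reindex _
      (Equiv.sigmaAssoc fun v w => (x v w).V))
    exact Decorated.ext_graph (V := Σ z : Σ v, W v, (x z.1 z.2).V)
      ((isSubstitution_subst K fun z => (x z.1 z.2).graph).unique
        (h.assoc (fun v => isSubstitution_subst (H v) fun w => (x v w).graph)
          (isSubstitution_subst G fun v => (H v).subst fun w => (x v w).graph))) _ _ _

end SGrProp

/-! ### The universal property of the free extension -/

namespace SGrProp

variable {s t : PastingScheme}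

section

variable {P : SGrProp.{u} s} {n m : SimplexCategoryᵒᵖ} {V : Type} [Finite V]
  {a b : V → Profile P.Color} {c d : Profile P.Color}

/-- Extensionality for morphisms that share a map of colours, which avoids heterogeneous
equalities between their maps of simplicial sets. -/
theorem Hom.mk_congr {P Q : SGrProp.{u} s} {φ : P.Color → Q.Color}
    {f g : ∀ c d, P.hom c d ⟶ Q.hom (c.map φ) (d.map φ)} {hf hg} (h : ∀ c d, f c d = g c d) :
    (Hom.mk φ f hf : Hom P Q) = Hom.mk φ g hg := by
  obtain rfl : f = g := funext fun c => funext (h c)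
  rfl

namespace FreeOp

/-- An operation of `P` as an operation of the free extension: the decorated standard corolla. -/
noncomputable def of (p : (P.hom c d).obj n) : FreeOp t P n c d :=
  mk ⟨_, _, _, corolla c d, mem_corolla t c d, fun _ => p⟩

theorem map_of (θ : n ⟶ m) (p : (P.hom c d).obj n) :
    map θ (of p : FreeOp t P n c d) = of ((P.hom c d).map θ p) :=
  map_mk θ _

/-- On graphs of the smaller pasting scheme the inclusion is compatible with compositions. -/
theorem of_comp (G : ColoredGraph a b c d) (hG : s.Mem G) (hG' : t.Mem G)
    (p : ∀ v, (P.hom (a v) (b v)).obj n) :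
    of ((P.comp G hG).app n p) = mk ⟨_, _, _, G, hG', p⟩ := by
  refine (mk_subst (isSubstitution_corolla_left G) (mem_corolla t c d) (fun _ => hG)
    (hG'.reindex _) fun _ => p).symm.trans ?_
  exact mk_reindex ⟨_, _, _, G, hG', p⟩ (unitSigma V)

/-- Every operation of the free extension is a composition of operations of `P`. -/
theorem comp_of (hst : IsExtension.{u} s t) (G : ColoredGraph a b c d) (hG : t.Mem G)
    (p : ∀ v, (P.hom (a v) (b v)).obj n) :
    comp hst G hG (fun v => of (p v)) = mk ⟨_, _, _, G, hG, p⟩ := by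
  refine (comp_mk hst G hG _).trans (Eq.trans (congrArg mk ?_)
    (mk_reindex ⟨_, _, _, G, hG, p⟩ (Equiv.sigmaUnique V fun _ => Unit)))
  exact Decorated.ext_graph (V := Σ _ : V, Unit) ((isSubstitution_subst _ _).unique
    (isSubstitution_corolla_right G)) _ _ _

end FreeOp

end

open FreeOp

/-- The inclusion of `P` into its free extension. -/
noncomputable def toFree (hst : IsExtension.{u} s t) (P : SGrProp.{u} s) :
    P ⟶ (forget hst.le).obj (free hst P) where
  color := id
  map c d :=
    { app := fun n => ↾ fun p => (FreeOp.of p : FreeOp t P n c d)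
      naturality := fun _ _ θ => by
        ext p
        exact (FreeOp.map_of θ p).symm }
  map_comp G hG n p := (of_comp G hG (hst.le G hG) p).trans (comp_of hst G (hst.le G hG) p).symm

theorem mapColors_corolla {C D : Type u} (f : C → D) (c d : Profile C) :
    (corolla c d).mapColors f = corolla (c.map f) (d.map f) :=
  ColoredGraph.ext (Equiv.ext (by rintro (i | p) <;> rfl))

/-- The value on a decorated graph of the extension of a morphism `P ⟶ Q` to the free
extension of `P`. -/
def Decorated.eval {P : SGrProp.{u} s} {Q : SGrProp.{u} t} (le : Le.{u} s t)
    (f : P ⟶ (forget le).obj Q) {n : SimplexCategoryᵒᵖ} {c d : Profile P.Color}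
    (x : Decorated t P n c d) : (Q.hom (c.map f.color) (d.map f.color)).obj n :=
  (Q.comp (x.graph.mapColors f.color) (x.mem.mapColors f.color)).app n
    fun v => (f.map (x.a v) (x.b v)).app n (x.op v)

/-- Evaluation is invariant under contractions by equivariance and associativity in `Q`. -/
theorem Contraction.eval_source {P : SGrProp.{u} s} {Q : SGrProp.{u} t} (le : Le.{u} s t)
    (f : P ⟶ (forget le).obj Q) {n : SimplexCategoryᵒᵖ} {c d : Profile P.Color}
    {y : Decorated t P n c d} (D : Contraction y) : D.source.eval le f = y.eval le f := by
  have : Finite D.V := D.source.finite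
  have h1 := Q.comp_iso (a := fun x => (D.a x.1 x.2).map f.color)
    (b := fun x => (D.b x.1 x.2).map f.color) D.σ
    (D.source.graph.mapColors f.color) (D.K.mapColors f.color)
    (D.source.mem.mapColors f.color) (D.mem_K.mapColors f.color)
    (reindex_isStrictIso D.σ (D.K.mapColors f.color)) n
    fun x => (f.map (D.a x.1 x.2) (D.b x.1 x.2)).app n (D.op x.1 x.2)
  have h2 := Q.comp_subst (y.graph.mapColors f.color) (fun v => (D.H v).mapColors f.color)
    (D.K.mapColors f.color) (y.mem.mapColors f.color)
    (fun v => (le _ (D.mem_H v)).mapColors f.color) (D.mem_K.mapColors f.color)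
    (D.isSubstitution.mapColors f.color) n
    fun v w => (f.map (D.a v w) (D.b v w)).app n (D.op v w)
  refine h1.trans (h2.trans (congrArg _ (funext fun v => ?_)))
  rw [D.op_eq]
  exact (f.map_comp (D.H v) (D.mem_H v) n (D.op v)).symm

theorem Decorated.eval_map {P : SGrProp.{u} s} {Q : SGrProp.{u} t} (le : Le.{u} s t)
    (f : P ⟶ (forget le).obj Q) {n m : SimplexCategoryᵒᵖ} {c d : Profile P.Color}
    (x : Decorated t P n c d) (θ : n ⟶ m) :
    (x.map θ).eval le f = (Q.hom _ _).map θ (x.eval le f) := by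
  refine Eq.trans (congrArg ((Q.comp (x.graph.mapColors f.color)
    (x.mem.mapColors f.color)).app m) (funext fun v => ?_)) (Q.comp_naturality _ _ θ _).symm
  exact ConcreteCategory.congr_hom ((f.map (x.a v) (x.b v)).naturality θ) (x.op v)

theorem Decorated.eval_subst {P : SGrProp.{u} s} {Q : SGrProp.{u} t} (hst : IsExtension.{u} s t)
    (f : P ⟶ (forget hst.le).obj Q) {n : SimplexCategoryᵒᵖ} {V : Type} [Finite V]
    {a b : V → Profile P.Color} {c d : Profile P.Color} (G : ColoredGraph a b c d) (hG : t.Mem G)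
    (x : ∀ v, Decorated t P n (a v) (b v)) :
    (Decorated.subst hst G hG x).eval hst.le f =
      (Q.comp (G.mapColors f.color) (hG.mapColors f.color)).app n
        fun v => (x v).eval hst.le f :=
  Q.comp_subst (G.mapColors f.color) (fun v => (x v).graph.mapColors f.color)
    ((G.subst fun v => (x v).graph).mapColors f.color) (hG.mapColors f.color)
    (fun v => (x v).mem.mapColors f.color) ((Decorated.subst hst G hG x).mem.mapColors f.color)
    ((isSubstitution_subst G fun v => (x v).graph).mapColors f.color) n
    fun v w => (f.map ((x v).a w) ((x v).b w)).app n ((x v).op w)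

namespace FreeOp

variable {P : SGrProp.{u} s} {Q : SGrProp.{u} t} {n m : SimplexCategoryᵒᵖ}

/-- The extension of a morphism `P ⟶ Q` to the operations of the free extension of `P`. -/
noncomputable def eval (le : Le.{u} s t) (f : P ⟶ (forget le).obj Q) {c d : Profile P.Color} :
    FreeOp t P n c d → (Q.hom (c.map f.color) (d.map f.color)).obj n :=
  FreeOp.lift (Decorated.eval le f) fun _ D => D.eval_source le f

theorem eval_mk (le : Le.{u} s t) (f : P ⟶ (forget le).obj Q) {c d : Profile P.Color}
    (x : Decorated t P n c d) : eval le f (FreeOp.mk x) = x.eval le f :=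
  lift_mk _ _ x

theorem eval_map (le : Le.{u} s t) (f : P ⟶ (forget le).obj Q) {c d : Profile P.Color}
    (θ : n ⟶ m) (p : FreeOp t P n c d) :
    eval le f (FreeOp.map θ p) = (Q.hom _ _).map θ (eval le f p) := by
  obtain ⟨x, rfl⟩ := exists_rep p
  rw [map_mk, eval_mk, eval_mk, Decorated.eval_map]

theorem eval_comp (hst : IsExtension.{u} s t) (f : P ⟶ (forget hst.le).obj Q) {V : Type}
    [Finite V] {a b : V → Profile P.Color} {c d : Profile P.Color} (G : ColoredGraph a b c d)
    (hG : t.Mem G) (p : ∀ v, FreeOp t P n (a v) (b v)) :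
    eval hst.le f (FreeOp.comp hst G hG p) =
      (Q.comp (G.mapColors f.color) (hG.mapColors f.color)).app n fun v => eval hst.le f (p v) := by
  choose x hx using fun v => exists_rep (p v)
  obtain rfl : (fun v => FreeOp.mk (x v)) = p := funext hx
  simp only [comp_mk, eval_mk, Decorated.eval_subst]
  rfl

theorem eval_of (le : Le.{u} s t) (f : P ⟶ (forget le).obj Q) {c d : Profile P.Color}
    (p : (P.hom c d).obj n) : eval le f (of p) = (f.map c d).app n p :=
  (eval_mk le f _).trans <| (Q.comp_congr rfl rfl
    (heq_of_eq (congrArg wire (mapColors_corolla f.color c d))) _ (mem_corolla t _ _) n _ _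
    fun _ => HEq.rfl).trans (Q.comp_corolla (c.map f.color) (d.map f.color) n ((f.map c d).app n p))

end FreeOp

/-- The extension of a morphism `P ⟶ Q` to the free extension of `P`. -/
noncomputable def freeLift {P : SGrProp.{u} s} {Q : SGrProp.{u} t} (hst : IsExtension.{u} s t)
    (f : P ⟶ (forget hst.le).obj Q) : free hst P ⟶ Q where
  color := f.color
  map c d :=
    { app := fun n => ↾ FreeOp.eval hst.le f
      naturality := fun _ _ θ => by
        ext p
        exact FreeOp.eval_map hst.le f θ p }
  map_comp G hG n p := FreeOp.eval_comp hst f G hG p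

/-- The universal property of the free extension. -/
noncomputable def freeHomEquiv (hst : IsExtension.{u} s t) (P : SGrProp.{u} s)
    (Q : SGrProp.{u} t) : (free hst P ⟶ Q) ≃ (P ⟶ (forget hst.le).obj Q) where
  toFun g := toFree hst P ≫ (forget hst.le).map g
  invFun f := freeLift hst f
  left_inv g := by
    obtain ⟨φ, g, hg⟩ := g
    refine Hom.mk_congr fun c d => ?_
    ext n p
    obtain ⟨x, rfl⟩ := exists_rep p
    have := x.finite
    refine (FreeOp.eval_mk hst.le _ x).trans ?_
    refine (hg x.graph x.mem n fun v => FreeOp.of (x.op v)).symm.trans ?_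
    exact congrArg ((g c d).app n) (comp_of hst x.graph x.mem x.op)
  right_inv f := by
    obtain ⟨φ, f, hf⟩ := f
    refine Hom.mk_congr fun c d => ?_
    ext n p
    exact FreeOp.eval_of hst.le _ p

/-- The free extension is left adjoint to the forgetful functor. -/
noncomputable def freeAdjunction (hst : IsExtension.{u} s t) :
    Adjunction.leftAdjointOfEquiv (G := forget hst.le) (freeHomEquiv hst)
      (fun _ _ _ _ _ => rfl) ⊣ forget hst.le :=
  Adjunction.adjunctionOfEquivLeft (freeHomEquiv hst) fun _ _ _ _ _ => rfl

theorem freeAdjunction_unit_app (hst : IsExtension.{u} s t) (P : SGrProp.{u} s) :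
    (freeAdjunction hst).unit.app P = toFree hst P := by
  refine (Adjunction.adjunctionOfEquivLeft_unit_app _ _ P).trans ?_
  rfl

end SGrProp

/-! ### The unit on isomorphisms of the categories of components -/

/-- A faithful functor, bijective on objects, is bijective on isomorphisms if its image on morphisms
contains all isomorphisms. -/
theorem bijective_mapIsos {C D : Type u} [Category.{u} C] [Category.{u} D] (F : C ⥤ D)
    [F.Faithful] (hobj : Function.Bijective F.obj)
    (h : ∀ (x y : C) (f : F.obj x ≅ F.obj y), ∃ g, F.map g = f.hom) :
    Function.Bijective (mapIsos F) := by
  constructor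
  · rintro ⟨x, y, f⟩ ⟨x', y', f'⟩ e
    obtain rfl : x = x' := hobj.1 (congrArg Sigma.fst e)
    have e1 := eq_of_heq (Sigma.mk.inj e).2
    obtain rfl : y = y' := hobj.1 (congrArg Sigma.fst e1)
    obtain rfl : f = f' := F.mapIso_injective (eq_of_heq (Sigma.mk.inj e1).2)
    rfl
  · rintro ⟨x, y, f⟩
    obtain ⟨x, rfl⟩ := hobj.2 x
    obtain ⟨y, rfl⟩ := hobj.2 y
    obtain ⟨g, hg⟩ := h x y f
    obtain ⟨g', hg'⟩ := h y x f.symm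
    refine ⟨⟨x, y, g, g', F.map_injective ?_, F.map_injective ?_⟩, ?_⟩
    · rw [F.map_comp, hg, hg', F.map_id]
      exact f.hom_inv_id
    · rw [F.map_comp, hg, hg', F.map_id]
      exact f.inv_hom_id
    · exact congrArg (fun e => (⟨F.obj x, F.obj y, e⟩ : Isos D)) (Iso.ext hg)

namespace SGrProp

variable {s t : PastingScheme} {P : SGrProp.{u} s} {n m : SimplexCategoryᵒᵖ}
  {c d : Profile P.Color}

open Classical in
/-- The composition of the decorations of a graph that belongs to the smaller pasting scheme. -/
noncomputable def Decorated.value (x : Decorated t P n c d) : Option ((P.hom c d).obj n) :=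
  if h : s.Mem x.graph then some ((P.comp x.graph h).app n x.op) else none

theorem Contraction.value_source (hst : IsExtension.{u} s t) {y : Decorated t P n c d}
    (D : Contraction y) : D.source.value = y.value := by
  have : Finite D.V := D.source.finite
  have h1 := hst.mem_iff D.isSubstitution y.mem D.mem_H
  have h2 : s.Mem D.source.graph ↔ s.Mem D.K := mem_reindex_iff D.σ
  by_cases h : s.Mem y.graph
  · have h3 := P.comp_iso (a := fun x => D.a x.1 x.2) (b := fun x => D.b x.1 x.2) D.σ
      D.source.graph D.K (h2.2 (h1.2 h)) (h1.2 h)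
      (reindex_isStrictIso D.σ D.K) n fun x => D.op x.1 x.2
    have h4 := P.comp_subst y.graph D.H D.K h D.mem_H (h1.2 h) D.isSubstitution n D.op
    rw [Decorated.value, Decorated.value, dif_pos h, dif_pos (h2.2 (h1.2 h))]
    refine congrArg some (h3.trans (h4.trans (congrArg _ (funext fun v => ?_))))
    exact (D.op_eq v).symm
  · rw [Decorated.value, Decorated.value, dif_neg h, dif_neg fun h' => h (h1.1 (h2.1 h'))]

namespace FreeOp

/-- The partial retraction of the free extension onto `P`: an operation given by a graph of the
smaller pasting scheme comes from an operation of `P`. -/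
noncomputable def value (hst : IsExtension.{u} s t) :
    FreeOp t P n c d → Option ((P.hom c d).obj n) :=
  lift Decorated.value fun _ D => D.value_source hst

theorem value_mk (hst : IsExtension.{u} s t) (x : Decorated t P n c d) :
    value hst (FreeOp.mk x) = x.value :=
  lift_mk _ _ x

theorem value_of (hst : IsExtension.{u} s t) (p : (P.hom c d).obj n) :
    value hst (of p) = some p := by
  refine (value_mk hst _).trans ((dif_pos (mem_corolla s c d)).trans (congrArg some ?_))
  exact P.comp_corolla c d n p

theorem eq_of_value_eq_some (hst : IsExtension.{u} s t) {f : FreeOp t P n c d}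
    {p : (P.hom c d).obj n} (h : value hst f = some p) : f = of p := by
  obtain ⟨x, rfl⟩ := exists_rep f
  rw [value_mk, Decorated.value] at h
  split_ifs at h with hx
  cases h
  exact (of_comp x.graph hx x.mem x.op).symm

theorem value_map (hst : IsExtension.{u} s t) (θ : n ⟶ m) (f : FreeOp t P n c d) :
    value hst (map θ f) = (value hst f).map ((P.hom c d).map θ) := by
  obtain ⟨x, rfl⟩ := exists_rep f
  rw [map_mk, value_mk, value_mk]
  by_cases h : s.Mem x.graph
  · rw [Decorated.value, Decorated.value, dif_pos h, dif_pos (show s.Mem (x.map θ).graph from h)]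
    exact congrArg some (P.comp_naturality x.graph h θ x.op).symm
  · rw [Decorated.value, Decorated.value, dif_neg h, dif_neg (show ¬ s.Mem (x.map θ).graph from h)]
    rfl

/-- If the retraction is defined on a composite of operations with one input and one output, then it
is defined on the first factor. -/
theorem value_linear_two (hst : IsExtension.{u} s t) (x : ℕ → P.Color)
    (f : ∀ v : Fin 2, FreeOp t P n (.single (x v.val)) (.single (x (v.val + 1))))
    (h : value hst (comp hst (linear 2 x) (mem_linear t 2 x) f) ≠ none) :
    value hst (f 0) ≠ none := by
  choose y hy using fun v => exists_rep (f v)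
  obtain rfl : (fun v => FreeOp.mk (y v)) = f := funext hy
  rw [comp_mk, value_mk, Decorated.value] at h
  have h1 : s.Mem (Decorated.subst hst (linear 2 x) (mem_linear t 2 x) y).graph := by
    by_contra h1
    exact h (dif_neg h1)
  have h2 := hst.mem_first (isSubstitution_subst (linear 2 x) fun v => (y v).graph)
    (fun v => (y v).mem) h1
  rw [value_mk, Decorated.value, dif_pos h2]
  exact Option.some_ne_none _

end FreeOp

/-- The partial retraction on connected components. -/
noncomputable def componentValue (hst : IsExtension.{u} s t) (P : SGrProp.{u} s)
    (c d : Profile P.Color) : SSet.π₀ ((free hst P).hom c d) → Option (SSet.π₀ (P.hom c d)) :=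
  SSet.π₀.lift (fun f => (FreeOp.value hst (f : FreeOp t P _ c d)).map SSet.π₀.mk) (by
    intro f f' e
    have key : ∀ {n} (θ : n ⟶ .op (.mk 0)) (q : FreeOp t P n c d),
        (FreeOp.value hst (FreeOp.map θ q)).map SSet.π₀.mk =
          (FreeOp.value hst q).map fun p => SSet.π₀.mk ((P.hom c d).map θ p) := by
      intro n θ q
      rw [FreeOp.value_map, Option.map_map]
      rfl
    refine (congrArg (fun f => (FreeOp.value hst f).map SSet.π₀.mk) e.src_eq).symm.trans
      (Eq.trans ?_ (congrArg (fun f => (FreeOp.value hst f).map SSet.π₀.mk) e.tgt_eq))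
    refine (key _ e.edge).trans (Eq.trans ?_ (key _ e.edge).symm)
    refine congrArg (fun g => (FreeOp.value hst e.edge).map g) (funext fun p => ?_)
    exact SSet.π₀.sound (SSet.Edge.mk p rfl rfl))

/-- The functor between categories of components that is induced by the inclusion into the free
extension. -/
noncomputable abbrev piZeroUnit (hst : IsExtension.{u} s t) (P : SGrProp.{u} s) :
    PiZero ((toSCat s).obj P) ⥤ PiZero ((toSCat s).obj ((forget hst.le).obj (free hst P))) :=
  piZeroMap ((toSCat s).map (toFree hst P))

variable (hst : IsExtension.{u} s t)

theorem componentValue_map {x y : PiZero ((toSCat s).obj P)} (f : x ⟶ y) :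
    componentValue hst P _ _ ((piZeroUnit hst P).map f) = some f := by
  change SSet.π₀ (P.hom _ _) at f
  induction f with
  | mk p => exact congrArg (Option.map SSet.π₀.mk) (FreeOp.value_of hst p)

theorem exists_map_eq {x y : PiZero ((toSCat s).obj P)}
    (f : (piZeroUnit hst P).obj x ⟶ (piZeroUnit hst P).obj y)
    (h : componentValue hst P (.single x) (.single y) f ≠ none) :
    ∃ g, (piZeroUnit hst P).map g = f := by
  change SSet.π₀ ((free hst P).hom (.single x) (.single y)) at f
  induction f with
  | mk f =>
    obtain ⟨p, hp⟩ := Option.ne_none_iff_exists'.1 (fun h' => h (congrArg (Option.map _) h') :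
      FreeOp.value hst (f : FreeOp t P _ (.single x) (.single y)) ≠ none)
    exact ⟨SSet.π₀.mk p, congrArg SSet.π₀.mk (FreeOp.eq_of_value_eq_some hst hp).symm⟩

theorem componentValue_comp {x y z : PiZero ((toSCat s).obj P)}
    (f : (piZeroUnit hst P).obj x ⟶ (piZeroUnit hst P).obj y)
    (g : (piZeroUnit hst P).obj y ⟶ (piZeroUnit hst P).obj z)
    (h : componentValue hst P (.single x) (.single z) (f ≫ g) ≠ none) :
    componentValue hst P (.single x) (.single y) f ≠ none := by
  change SSet.π₀ ((free hst P).hom (.single x) (.single y)) at f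
  change SSet.π₀ ((free hst P).hom (.single y) (.single z)) at g
  induction f with
  | mk f =>
    induction g with
    | mk g =>
      intro h'
      have h1 := Option.map_eq_none_iff.1 h'
      refine FreeOp.value_linear_two hst (seq₃ x y z)
        (fun v => (((forget hst.le).obj (free hst P)).pair f g v)) (fun h2 => h ?_) h1
      exact congrArg (Option.map _) h2

instance : (piZeroUnit hst P).Faithful where
  map_injective {x y f g} h := Option.some_injective _ (by
    rw [← componentValue_map hst f, ← componentValue_map hst g, h])

/-- The retraction is defined on every isomorphism `f`, since it is defined on the identity
`f ≫ f⁻¹`. -/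
theorem bijective_mapIsos_piZeroUnit : Function.Bijective (mapIsos (piZeroUnit hst P)) := by
  refine bijective_mapIsos _ Function.bijective_id fun x y f => exists_map_eq hst f.hom ?_
  refine componentValue_comp hst f.hom f.inv ?_
  have h1 : f.hom ≫ f.inv = (piZeroUnit hst P).map (𝟙 x) :=
    f.hom_inv_id.trans ((piZeroUnit hst P).map_id x).symm
  have h2 := (congrArg (componentValue hst P (.single x) (.single x)) h1).trans
    (componentValue_map hst (𝟙 x))
  exact fun h => Option.some_ne_none _ (h2.symm.trans h)

theorem categoricallyWellBehaved_freeAdjunction :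
    CategoricallyWellBehaved (toSCat s) (freeAdjunction hst) := by
  intro P
  rw [freeAdjunction_unit_app]
  exact ⟨⟨rfl, fun _ => rfl⟩, bijective_mapIsos_piZeroUnit hst⟩

end SGrProp

end GraphProp

theorem mainTheorem6 :
    (∃ (L₁ : GraphProp.SDioperad.{u} ⥤ GraphProp.SProperad.{u})
      (adj₁ : L₁ ⊣ GraphProp.properadToDioperad.{u}),
      GraphProp.CategoricallyWellBehaved
        (GraphProp.SGrProp.toSCat GraphProp.PastingScheme.simplyConnected) adj₁) ∧
    (∃ (L₀ : GraphProp.SProperad.{u} ⥤ GraphProp.SProp.{u})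
      (adj₀ : L₀ ⊣ GraphProp.propToProperad.{u}),
      GraphProp.CategoricallyWellBehaved
        (GraphProp.SGrProp.toSCat GraphProp.PastingScheme.connected) adj₀) :=
  ⟨⟨_, _, GraphProp.SGrProp.categoricallyWellBehaved_freeAdjunction
      GraphProp.PastingScheme.isExtension_simplyConnected_connected⟩,
    _, _, GraphProp.SGrProp.categoricallyWellBehaved_freeAdjunction
      GraphProp.PastingScheme.isExtension_connected_all⟩
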